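/- Let $(\mathcal X,\rho)$ be a complete separable metric space, and let $(P_t)_{t\ge 0}$ be the transition semigroup of a Markov family on $\mathcal X$: probability kernels $P_t(x,dy)$ with $P_0(x,\cdot)=\delta_x$ and $P_{s+t}=P_sP_t$, acting on bounded measurable functions by $P_t\psi(x)=\int\psi(y)\,P_t(x,dy)$ and on Borel probability measures by $P_t^*\mu=\int P_t(x,\cdot)\,\mu(dx)$. Assume that $(P_t)$ is Feller ($P_t$ maps bounded continuous functions to bounded continuous functions) and stochastically continuous ($\lim_{t\to0+}P_t\psi(x)=\psi(x)$ for all $x\in\mathcal X$ and all bounded continuous $\psi$). For $T>0$ put $Q^T\mu=\frac1T\int_0^T P_s^*\mu\,ds$ and $Q^T(x,\cdot)=Q^T\delta_x$, and let $\mathcal T$ be the set of those $x\in\mathcal X$ for which the family $(Q^T(x,\cdot))_{T>0}$ is tight. Let $B(z,\delta)$ be the ball with center $z$ and radius $\delta$. Assume: (a) (e-property) for every bounded Lipschitz $\psi:\mathcal X\to\mathbb R$, $x\in\mathcal X$ and $\varepsilon>0$ there is $\delta>0$ such that $|P_t\psi(x)-P_t\psi(y)|<\varepsilon$ for all $y\in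 B(x,\delta)$ and all $t\ge0$; (b) there is $z\in\mathcal X$ such that $\liminf_{T\to\infty}Q^T(x,B(z,\delta))>0$ for all $\delta>0$ and $x\in\mathcal X$; (c) there is $z\in\mathcal X$ such that $\inf_{x\in A}\liminf_{T\to\infty}Q^T(x,B(z,\delta))>0$ for every bounded set $A\subset\mathcal X$ and every $\delta>0$; (d) for every $\varepsilon>0$ and $x\in\mathcal X$ there is a bounded Borel set $D\subset\mathcal X$ with $\liminf_{T\to\infty}Q^T(x,D)>1-\varepsilon$. Then $\mathcal T=\mathcal X$, and $(P_t)$ has a unique invariant probability measure $\mu_*$ (that is, a unique Borel probability measure with $P_t^*\mu_*=\mu_*$ for all $t\ge 0$). Moreover: (1) $(P_t)$ is weak-$^*$ mean ergodic: $Q^T\nu\to\mu_*$ weakly as $T\to\infty$ for every Borel probability measure $\nu$ on $\mathcal X$; (2) for every bounded Lipschitz $\psi$ and every Borel probability measure $\mu$ on $\mathcal X$, if $(Z(t))_{t\ge0}$ is a (jointly measurable) Markov process with transition semigroup $(P_t)$ and initial distribution $\mu$, defined on a probability space with measure $\mathbb P_\mu$, then $$\frac1T\int_0^T\psi(Z(t))\,dt\longrightarrow\int_{\mathcal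 X}\psi\,d\mu_*\qquad(T\to\infty)$$ in $\mathbb P_\mu$-probability. -/

import Mathlib

open MeasureTheory ProbabilityTheory Filter Topology
open scoped NNReal ENNReal BoundedContinuousFunction

namespace MarkovErgodic

variable {X : Type*} [MeasurableSpace X]

/-- The family `(P_t)_{t ≥ 0}` of probability kernels on `X` is a transition semigroup:
`P_0` is the identity and the Chapman-Kolmogorov equations hold. The operator `P_t` acts on
functions by `P_t ψ (x) = ∫ y, ψ y ∂(P t x)`, and on measures by `P_t^* μ = P t ∘ₘ μ`. -/
structure IsTransitionSemigroup (P : ℝ≥0 → Kernel X X) : Prop where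
  markov : ∀ t, IsMarkovKernel (P t)
  zero : P 0 = Kernel.id
  add : ∀ s t, P (s + t) = P t ∘ₖ P s

/-- `P_t` maps bounded continuous functions to (bounded) continuous functions. -/
def IsFeller [TopologicalSpace X] (P : ℝ≥0 → Kernel X X) : Prop :=
  ∀ (t : ℝ≥0) (ψ : X →ᵇ ℝ), Continuous fun x => ∫ y, ψ y ∂(P t x)

/-- Stochastic continuity, expressed on the semigroup: `P_t ψ (x) → ψ x` as `t → 0+` for all
`x` and all bounded continuous `ψ`, i.e. `P_t(x, ·)` converges weakly to `δ_x`. -/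
def IsStochasticallyContinuous [TopologicalSpace X] (P : ℝ≥0 → Kernel X X) : Prop :=
  ∀ (x : X) (ψ : X →ᵇ ℝ), Tendsto (fun t => ∫ y, ψ y ∂(P t x)) (𝓝[>] 0) (𝓝 (ψ x))

/-- `ψ` is a bounded Lipschitz function. -/
def IsLipBounded [PseudoEMetricSpace X] (ψ : X → ℝ) : Prop :=
  (∃ K : ℝ≥0, LipschitzWith K ψ) ∧ ∃ C : ℝ, ∀ x, |ψ x| ≤ C

/-- The e-property: for every bounded Lipschitz `ψ`, the family `(P_t ψ)_{t ≥ 0}` is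
equicontinuous at every point. -/
def EProperty [MetricSpace X] (P : ℝ≥0 → Kernel X X) : Prop :=
  ∀ ψ : X → ℝ, IsLipBounded ψ → ∀ x : X, ∀ ε > 0, ∃ δ > 0, ∀ z ∈ Metric.ball x δ, ∀ t : ℝ≥0,
    |∫ y, ψ y ∂(P t x) - ∫ y, ψ y ∂(P t z)| < ε

/-- The time average `Q^T μ = T⁻¹ ∫_0^T P_s^* μ ds`, for `T > 0`, as a mixture of measures.
For a stochastically continuous Feller semigroup on a separable metric space, `s ↦ P_s^* μ` is
automatically measurable, so that `Q^T μ (B) = T⁻¹ ∫_0^T ∫ P_s(x, B) μ(dx) ds` for Borel `B`. -/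
noncomputable def timeAverage (P : ℝ≥0 → Kernel X X) (T : ℝ) (μ : Measure X) : Measure X :=
  (ENNReal.ofReal T)⁻¹ •
    (volume.restrict (Set.Ioc 0 T)).bind fun s : ℝ => P s.toNNReal ∘ₘ μ

/-- `Q^T(x, ·) = Q^T δ_x`. -/
noncomputable def timeAverageAt (P : ℝ≥0 → Kernel X X) (T : ℝ) (x : X) : Measure X :=
  timeAverage P T (Measure.dirac x)

/-- The set `𝒯` of those points `x` for which the family `(Q^T(x, ·))_{T > 0}` is tight. -/
def tightPoints [TopologicalSpace X] (P : ℝ≥0 → Kernel X X) : Set X :=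
  {x | IsTightMeasureSet {ν : Measure X | ∃ T : ℝ, 0 < T ∧ ν = timeAverageAt P T x}}

/-- `μ` is an invariant probability measure: `P_t^* μ = μ` for all `t ≥ 0`. -/
def IsInvariantProb (P : ℝ≥0 → Kernel X X) (μ : Measure X) : Prop :=
  IsProbabilityMeasure μ ∧ ∀ t, P t ∘ₘ μ = μ

/-- `(P_t)` is weak-* mean ergodic with limit the probability measure `μ'`: for every
probability measure `ν`, the averages `Q^T ν` converge weakly to `μ'` as `T → ∞`. -/
def IsWeakStarMeanErgodicTo [TopologicalSpace X] (P : ℝ≥0 → Kernel X X) (μ' : Measure X) :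
    Prop :=
  IsProbabilityMeasure μ' ∧
    ∀ ν : Measure X, IsProbabilityMeasure ν → ∀ ψ : X →ᵇ ℝ,
      Tendsto (fun T : ℝ => ∫ x, ψ x ∂(timeAverage P T ν)) atTop (𝓝 (∫ x, ψ x ∂μ'))

/-- `(P_t)` is weak-* mean ergodic. -/
def IsWeakStarMeanErgodic [TopologicalSpace X] (P : ℝ≥0 → Kernel X X) : Prop :=
  ∃ μ' : Measure X, IsWeakStarMeanErgodicTo P μ'

/-- The process `(Z(t))_{t ≥ 0}` on the probability space `(Ω, Pr)` is a (jointly measurable)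
Markov process with transition semigroup `(P_t)` and initial distribution `μ`. The Markov
property is the one with respect to the filtration `σ(Z(r), r ≤ s)` of the process itself. -/
structure IsMarkovProcess {Ω : Type*} [MeasurableSpace Ω] (P : ℝ≥0 → Kernel X X)
    (μ : Measure X) (Pr : Measure Ω) (Z : ℝ≥0 → Ω → X) : Prop where
  isProbabilityMeasure : IsProbabilityMeasure Pr
  measurable : Measurable (Function.uncurry Z)
  initial : Pr.map (Z 0) = μ
  markov : ∀ (s t : ℝ≥0) (B : Set X), MeasurableSet B →
    Pr⟦Z (s + t) ⁻¹' B | ⨆ r : Set.Iic s, MeasurableSpace.comap (Z r) inferInstance⟧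
      =ᵐ[Pr] fun ω => (P t (Z s ω)).real B

end MarkovErgodic

/-! The argument has four ingredients, each resting on the e-property or on the lower bounds for the
time averages `Q^T`.

Tightness at one point (`isTightMeasureSet_timeAverageAt`). If the averages started at `z` were not
tight, there would be disjointly supported, uniformly Lipschitz bumps `g n` and times `t n` with
`P_{t n} (g n) (z) ≥ ε`. A Baire argument (`EProperty.exists_uniform`) makes the e-property uniform
in large `n`, so `P_{t n} (g n) ≥ ε / 2` on a common ball around `z`. The averages charge that ball
and are almost invariant under `P_{t n}`, so each `g n` has average bounded below; the sum of enough
disjoint bumps then has average above `1`. A limit point of the tight family is an invariant measure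
(Krylov–Bogoliubov).

Liouville property (`IsMeasurableSemigroup.eq_of_invariant`). For a bounded continuous harmonic `f`,
the functions `P_s (f ^ 2)` increase to some `h`, and the averages of `h - f ^ 2` tend to zero. At a
point `y` of a bounded set, `h - f ^ 2` dominates the variance of `f` under `Q^T(y, ·)`, which is
bounded below where `f y` differs from `f z`, because `Q^T(y, ·)` charges small balls around `z`. As
bounded sets carry almost all the mass in the limit, `f x = f z`.

Convergence (`tendsto_avg`). The averages of a bounded Lipschitz `ψ` are equicontinuous, so every
sequence of times has a subsequence along which they converge pointwise. The limit is continuous and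
harmonic, hence constant, and integration against an invariant measure identifies the constant. Weak
convergence, uniqueness and tightness at every point follow.

Law of large numbers (`IsMarkovProcess.integral_sq_le`). By the Markov property the second moment of
a centred path average is controlled by suprema of averages over long time intervals. These suprema
are continuous by the e-property, so weak convergence of `Q^T μ` applies to them. -/

namespace MarkovErgodic

/-! ### Joint measurability of the semigroup and calculus of time averages -/

section Measurability

variable {X : Type*} [MeasurableSpace X] {P : ℝ≥0 → Kernel X X}

/-- The function `P_s ψ`, with the time `s` read as a real number. -/
noncomputable def act (P : ℝ≥0 → Kernel X X) (ψ : X → ℝ) (s : ℝ) (x : X) : ℝ :=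
  ∫ y, ψ y ∂(P s.toNNReal x)

/-- The time average `T⁻¹ ∫_0^T P_s ψ (x) ds`. -/
noncomputable def avg (P : ℝ≥0 → Kernel X X) (ψ : X → ℝ) (T : ℝ) (x : X) : ℝ :=
  T⁻¹ * ∫ s in (0 : ℝ)..T, act P ψ s x

/-- A transition semigroup that is jointly measurable in time and space. -/
structure IsMeasurableSemigroup (P : ℝ≥0 → Kernel X X) : Prop extends IsTransitionSemigroup P where
  measurable_uncurry : Measurable fun p : ℝ × X => P p.1.toNNReal p.2

theorem integrable_of_bound {μ : Measure X} [IsFiniteMeasure μ] {ψ : X → ℝ} {C : ℝ}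
    (hψ : Measurable ψ) (hC : ∀ x, |ψ x| ≤ C) : Integrable ψ μ :=
  Integrable.of_bound hψ.aestronglyMeasurable C (ae_of_all _ hC)

theorem abs_integral_le_of_bound {μ : Measure X} [IsProbabilityMeasure μ] {ψ : X → ℝ} {C : ℝ}
    (hC : ∀ x, |ψ x| ≤ C) : |∫ x, ψ x ∂μ| ≤ C := by
  simpa using norm_integral_le_of_norm_le_const (μ := μ) (f := ψ) (ae_of_all _ hC)

theorem abs_intervalIntegral_le {f : ℝ → ℝ} {C a b : ℝ} (hC : ∀ x, |f x| ≤ C) (hab : a ≤ b) :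
    |∫ s in a..b, f s| ≤ C * (b - a) := by
  have := intervalIntegral.norm_integral_le_of_norm_le_const (a := a) (b := b) (f := f) (C := C)
    fun x _ => hC x
  rwa [abs_of_nonneg (sub_nonneg.2 hab)] at this

theorem IsTransitionSemigroup.integral_add (hP : IsTransitionSemigroup P) (s t : ℝ≥0) (x : X)
    {ψ : X → ℝ} {C : ℝ} (hψ : Measurable ψ) (hC : ∀ x, |ψ x| ≤ C) :
    ∫ y, ψ y ∂(P (s + t) x) = ∫ y, ∫ w, ψ w ∂(P t y) ∂(P s x) := by
  have := hP.markov
  rw [hP.add s t, Kernel.integral_comp (integrable_of_bound hψ hC)]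

section Topological

variable [TopologicalSpace X] [BorelSpace X]

/-- Writing `P_t ψ = P_{t-s} (P_s ψ)` moves the question to time `0`: by the Feller property `P_s ψ`
is an admissible test function for stochastic continuity. -/
theorem continuousWithinAt_integral (hP : IsTransitionSemigroup P) (hF : IsFeller P)
    (hC : IsStochasticallyContinuous P) (ψ : X →ᵇ ℝ) (x : X) (s : ℝ≥0) :
    ContinuousWithinAt (fun s => ∫ y, ψ y ∂(P s x)) (Set.Ioi s) s := by
  have := hP.markov
  have hb : ∀ (t : ℝ≥0) y, |∫ y, ψ y ∂(P t y)| ≤ ‖ψ‖ := fun t y =>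
    abs_integral_le_of_bound fun x => ψ.norm_coe_le_norm x
  let φ : X →ᵇ ℝ := BoundedContinuousFunction.ofNormedAddCommGroup _ (hF s ψ) ‖ψ‖ (hb s)
  have h1 := hC x φ
  have h2 : Tendsto (fun t : ℝ≥0 => t - s) (𝓝[>] s) (𝓝[>] 0) := by
    refine tendsto_nhdsWithin_iff.2 ⟨?_, ?_⟩
    · have : Tendsto (fun t : ℝ≥0 => t - s) (𝓝 s) (𝓝 (s - s)) := by
        exact (continuous_id.sub continuous_const).tendsto s
      rw [tsub_self] at this
      exact this.mono_left nhdsWithin_le_nhds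
    · filter_upwards [self_mem_nhdsWithin] with t ht
      exact tsub_pos_of_lt (Set.mem_Ioi.1 ht)
  refine (h1.comp h2).congr' ?_
  filter_upwards [self_mem_nhdsWithin] with t ht
  have e : t = (t - s) + s := (tsub_add_cancel_of_le (le_of_lt ht)).symm
  conv_rhs => rw [e, hP.integral_add _ _ x ψ.continuous.measurable ψ.norm_coe_le_norm]
  rfl

/-- Right-continuity in time and continuity in space suffice: discretising time from the right
exhibits the function as a pointwise limit of measurable ones. -/
theorem measurable_integral_uncurry (hP : IsTransitionSemigroup P) (hF : IsFeller P)
    (hC : IsStochasticallyContinuous P) (ψ : X →ᵇ ℝ) :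
    Measurable fun p : ℝ≥0 × X => ∫ y, ψ y ∂(P p.1 p.2) := by
  -- The `+ 1` after the floor keeps the grid time strictly above `s`, since only right limits are
  -- available.
  let r : ℕ → ℝ≥0 → ℝ≥0 := fun n s => ((⌊(n + 1) * s⌋₊ : ℝ≥0) + 1) / (n + 1)
  have hr : ∀ s, Tendsto (fun n => r n s) atTop (𝓝[>] s) := by
    intro s
    refine tendsto_nhdsWithin_iff.2 ⟨?_, Eventually.of_forall fun n => ?_⟩
    · have hlim : Tendsto (fun n : ℕ => s + 1 / ((n : ℝ≥0) + 1)) atTop (𝓝 (s + 0)) :=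
        tendsto_const_nhds.add tendsto_one_div_add_atTop_nhds_zero_nat
      rw [add_zero] at hlim
      refine tendsto_of_tendsto_of_tendsto_of_le_of_le tendsto_const_nhds hlim (fun n => ?_)
        (fun n => ?_)
      · have := (Nat.lt_floor_add_one (((n : ℝ≥0) + 1) * s)).le
        rw [le_div_iff₀ (by positivity), mul_comm]
        exact this
      · have := Nat.floor_le (a := ((n : ℝ≥0) + 1) * s) (by positivity)
        simp only [r]
        rw [add_div]
        gcongr
        rwa [div_le_iff₀ (by positivity), mul_comm s]
    · have := (Nat.lt_floor_add_one (((n : ℝ≥0) + 1) * s))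
      simp only [Set.mem_Ioi, r]
      rw [lt_div_iff₀ (by positivity), mul_comm]
      exact this
  refine measurable_of_tendsto_metrizable (f := fun n p => ∫ y, ψ y ∂(P (r n p.1) p.2))
    (fun n => ?_) ?_
  · let F : ℕ × X → ℝ := fun q => ∫ y, ψ y ∂(P (((q.1 : ℝ≥0) + 1) / (n + 1)) q.2)
    have h1 : Measurable F := measurable_from_prod_countable_right fun k =>
      (hF (((k : ℝ≥0) + 1) / (n + 1)) ψ).measurable
    have h3 : Measurable fun p : ℝ≥0 × X => ⌊((n : ℝ≥0) + 1) * p.1⌋₊ :=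
      Nat.measurable_floor.comp (measurable_fst.const_mul _)
    have h4 : Measurable fun p : ℝ≥0 × X => (⌊((n : ℝ≥0) + 1) * p.1⌋₊, p.2) :=
      h3.prodMk measurable_snd
    have h5 := h1.comp h4
    simp only [F, Function.comp_def] at h5
    exact h5
  · rw [tendsto_pi_nhds]
    intro p
    exact (continuousWithinAt_integral hP hF hC ψ p.2 p.1).tendsto.comp (hr p.1)

/-- Closed sets form a generating π-system, and their indicators are limits of bounded continuous
functions, to which the preceding lemma applies. -/
theorem isMeasurableSemigroup [HasOuterApproxClosed X] (hP : IsTransitionSemigroup P)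
    (hF : IsFeller P) (hC : IsStochasticallyContinuous P) : IsMeasurableSemigroup P := by
  refine ⟨hP, ?_⟩
  have := hP.markov
  suffices h : Measurable fun p : ℝ≥0 × X => P p.1 p.2 from
    h.comp ((measurable_real_toNNReal.comp measurable_fst).prodMk measurable_snd)
  refine Measurable.measure_of_isPiSystem_of_isProbabilityMeasure (S := {s | IsClosed s})
    ?_ isPiSystem_isClosed fun F hFc => ?_
  · rw [BorelSpace.measurable_eq (α := X), borel_eq_generateFrom_isClosed]
  · refine measurable_of_tendsto_metrizable
      (f := fun n p => ∫⁻ y, (IsClosed.apprSeq hFc n y : ℝ≥0∞) ∂(P p.1 p.2)) (fun n => ?_) ?_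
    · let φ : X →ᵇ ℝ := BoundedContinuousFunction.ofNormedAddCommGroup
        (fun y => (IsClosed.apprSeq hFc n y : ℝ)) (by fun_prop) 1 (fun y => by
          simpa using HasOuterApproxClosed.apprSeq_apply_le_one hFc n y)
      convert (measurable_integral_uncurry hP hF hC φ).ennreal_ofReal using 2 with p
      rw [ofReal_integral_eq_lintegral_ofReal (integrable_of_bound φ.continuous.measurable
        φ.norm_coe_le_norm) (ae_of_all _ fun y => NNReal.coe_nonneg _)]
      simp [φ]
    · rw [tendsto_pi_nhds]
      intro p
      exact HasOuterApproxClosed.tendsto_lintegral_apprSeq hFc _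

end Topological

namespace IsMeasurableSemigroup

theorem measurable_act (hm : IsMeasurableSemigroup P) {ψ : X → ℝ} (hψ : Measurable ψ) :
    Measurable fun p : ℝ × X => act P ψ p.1 p.2 := by
  have := hm.markov
  let κ : Kernel (ℝ × X) X := ⟨_, hm.measurable_uncurry⟩
  exact (hψ.stronglyMeasurable.integral_kernel (κ := κ)).measurable

theorem abs_act_le (hm : IsMeasurableSemigroup P) {ψ : X → ℝ} {C : ℝ} (hC : ∀ x, |ψ x| ≤ C)
    (s : ℝ) (x : X) : |act P ψ s x| ≤ C := by
  have := hm.markov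
  exact abs_integral_le_of_bound hC

theorem measurable_act_right (hm : IsMeasurableSemigroup P) {ψ : X → ℝ} (hψ : Measurable ψ)
    (s : ℝ) : Measurable (act P ψ s) :=
  (hm.measurable_act hψ).comp measurable_prodMk_left

theorem measurable_act_left (hm : IsMeasurableSemigroup P) {ψ : X → ℝ} (hψ : Measurable ψ)
    (x : X) : Measurable fun s => act P ψ s x :=
  (hm.measurable_act hψ).comp measurable_prodMk_right

theorem act_add (hm : IsMeasurableSemigroup P) {ψ : X → ℝ} {C : ℝ} (hψ : Measurable ψ)
    (hC : ∀ x, |ψ x| ≤ C) {s t : ℝ} (hs : 0 ≤ s) (ht : 0 ≤ t) (x : X) :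
    act P ψ (s + t) x = act P (act P ψ t) s x := by
  rw [act, Real.toNNReal_add hs ht, hm.integral_add _ _ x hψ hC]
  rfl

theorem intervalIntegrable_act (hm : IsMeasurableSemigroup P) {ψ : X → ℝ} {C : ℝ}
    (hψ : Measurable ψ) (hC : ∀ x, |ψ x| ≤ C) (x : X) (a b : ℝ) :
    IntervalIntegrable (fun s => act P ψ s x) volume a b := by
  rw [intervalIntegrable_iff]
  exact Measure.integrableOn_of_bounded (M := C) (by simp)
    (hm.measurable_act_left hψ x).aestronglyMeasurable (ae_of_all _ fun s => hm.abs_act_le hC s x)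

theorem abs_avg_le (hm : IsMeasurableSemigroup P) {ψ : X → ℝ} {C : ℝ}
    (hC : ∀ x, |ψ x| ≤ C) {T : ℝ} (hT : 0 < T) (x : X) : |avg P ψ T x| ≤ C := by
  rw [avg, abs_mul, abs_inv, abs_of_pos hT, inv_mul_le_iff₀ hT]
  have := abs_intervalIntegral_le (a := 0) (b := T) (fun s => hm.abs_act_le hC s x) hT.le
  linarith

/-- The laws `P_s^* μ` form a kernel in the real time variable `s`. -/
theorem measurable_comp (hm : IsMeasurableSemigroup P) (μ : Measure X) [SFinite μ] :
    Measurable fun s : ℝ => P s.toNNReal ∘ₘ μ := by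
  refine Measure.measurable_of_measurable_coe _ fun B hB => ?_
  simp_rw [Measure.bind_apply hB (Kernel.aemeasurable _)]
  exact Measurable.lintegral_prod_right'
    (f := fun p : ℝ × X => P p.1.toNNReal p.2 B)
    ((Measure.measurable_coe hB).comp hm.measurable_uncurry)

theorem isProbabilityMeasure_comp (hm : IsMeasurableSemigroup P) (μ : Measure X)
    [IsProbabilityMeasure μ] (t : ℝ≥0) : IsProbabilityMeasure (P t ∘ₘ μ) := by
  have := hm.markov
  infer_instance

theorem isProbabilityMeasure_timeAverage (hm : IsMeasurableSemigroup P) (μ : Measure X)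
    [IsProbabilityMeasure μ] {T : ℝ} (hT : 0 < T) :
    IsProbabilityMeasure (timeAverage P T μ) := by
  have := hm.markov
  constructor
  rw [timeAverage, Measure.smul_apply, Measure.bind_apply .univ (hm.measurable_comp μ).aemeasurable]
  have : ∀ s : ℝ, (P s.toNNReal ∘ₘ μ) Set.univ = 1 := fun s => measure_univ
  simp [this]
  exact ENNReal.inv_mul_cancel (by simpa using hT) ENNReal.ofReal_ne_top

theorem integral_comp_eq (hm : IsMeasurableSemigroup P) (μ : Measure X) [IsProbabilityMeasure μ]
    {ψ : X → ℝ} {C : ℝ} (hψ : Measurable ψ) (hC : ∀ x, |ψ x| ≤ C) (t : ℝ) :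
    ∫ x, ψ x ∂(P t.toNNReal ∘ₘ μ) = ∫ x, act P ψ t x ∂μ := by
  have := hm.markov
  rw [Measure.comp_eq_comp_const_apply, Kernel.integral_comp (integrable_of_bound hψ hC)]
  rfl

theorem integral_timeAverage' (hm : IsMeasurableSemigroup P) (μ : Measure X)
    [IsProbabilityMeasure μ] {ψ : X → ℝ} {C : ℝ} (hψ : Measurable ψ) (hC : ∀ x, |ψ x| ≤ C)
    {T : ℝ} (hT : 0 < T) :
    ∫ x, ψ x ∂(timeAverage P T μ) = T⁻¹ * ∫ s in (0 : ℝ)..T, ∫ x, act P ψ s x ∂μ := by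
  have := hm.markov
  let κ : Kernel ℝ X := ⟨_, hm.measurable_comp μ⟩
  have hκ : IsMarkovKernel κ := ⟨fun s => hm.isProbabilityMeasure_comp μ _⟩
  have e : timeAverage P T μ = (ENNReal.ofReal T)⁻¹ • (κ ∘ₘ volume.restrict (Set.Ioc 0 T)) := rfl
  rw [e, integral_smul_measure, Measure.comp_eq_comp_const_apply,
    Kernel.integral_comp (integrable_of_bound hψ hC), intervalIntegral.integral_of_le hT.le]
  simp only [ENNReal.toReal_inv, ENNReal.toReal_ofReal hT.le, smul_eq_mul, Kernel.const_apply]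
  congr 2
  ext s
  exact hm.integral_comp_eq μ hψ hC s

theorem integral_timeAverage (hm : IsMeasurableSemigroup P) (μ : Measure X)
    [IsProbabilityMeasure μ] {ψ : X → ℝ} {C : ℝ} (hψ : Measurable ψ) (hC : ∀ x, |ψ x| ≤ C)
    {T : ℝ} (hT : 0 < T) :
    ∫ x, ψ x ∂(timeAverage P T μ) = ∫ x, avg P ψ T x ∂μ := by
  rw [hm.integral_timeAverage' μ hψ hC hT]
  simp only [avg, integral_const_mul, intervalIntegral.integral_of_le hT.le]
  rw [integral_integral_swap]
  exact Integrable.of_bound (hm.measurable_act hψ).aestronglyMeasurable C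
    (ae_of_all _ fun p => hm.abs_act_le hC _ _)

theorem integral_timeAverageAt (hm : IsMeasurableSemigroup P) (x : X) {ψ : X → ℝ} {C : ℝ}
    (hψ : Measurable ψ) (hC : ∀ x, |ψ x| ≤ C) {T : ℝ} (hT : 0 < T) :
    ∫ y, ψ y ∂(timeAverageAt P T x) = avg P ψ T x := by
  rw [timeAverageAt, hm.integral_timeAverage' _ hψ hC hT, avg]
  congr 2
  ext s
  exact integral_dirac' _ _ (hm.measurable_act_right hψ s).stronglyMeasurable

theorem measurable_avg (hm : IsMeasurableSemigroup P) {ψ : X → ℝ} (hψ : Measurable ψ) {T : ℝ}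
    (hT : 0 ≤ T) : Measurable (avg P ψ T) := by
  unfold avg
  simp_rw [intervalIntegral.integral_of_le hT]
  refine Measurable.const_mul ?_ _
  exact (StronglyMeasurable.integral_prod_left (f := fun s x => act P ψ s x)
    (hm.measurable_act hψ).stronglyMeasurable).measurable

/-- Together with `avg_act` this shows that the semigroup commutes with time averaging: both orders
give the average over the shifted window. -/
theorem act_avg (hm : IsMeasurableSemigroup P) {ψ : X → ℝ} {C : ℝ} (hψ : Measurable ψ)
    (hC : ∀ x, |ψ x| ≤ C) {T t : ℝ} (hT : 0 < T) (ht : 0 ≤ t) (x : X) :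
    act P (avg P ψ T) t x = T⁻¹ * ∫ s in (0 : ℝ)..T, act P ψ (s + t) x := by
  have := hm.markov
  rw [act, ← hm.integral_timeAverage _ hψ hC hT, hm.integral_timeAverage' _ hψ hC hT]
  congr 1
  refine intervalIntegral.integral_congr fun s hs => ?_
  rw [Set.uIcc_of_le hT.le] at hs
  rw [add_comm, hm.act_add hψ hC ht hs.1]
  rfl

theorem avg_act (hm : IsMeasurableSemigroup P) {ψ : X → ℝ} {C : ℝ} (hψ : Measurable ψ)
    (hC : ∀ x, |ψ x| ≤ C) {T t : ℝ} (hT : 0 < T) (ht : 0 ≤ t) (x : X) :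
    avg P (act P ψ t) T x = T⁻¹ * ∫ s in (0 : ℝ)..T, act P ψ (s + t) x := by
  rw [avg]
  congr 1
  refine intervalIntegral.integral_congr fun s hs => ?_
  rw [Set.uIcc_of_le hT.le] at hs
  exact (hm.act_add hψ hC hs.1 ht x).symm

/-- Time averages are almost invariant under the semigroup. -/
theorem abs_avg_act_sub_avg_le (hm : IsMeasurableSemigroup P) {ψ : X → ℝ} {C : ℝ}
    (hψ : Measurable ψ) (hC : ∀ x, |ψ x| ≤ C) {T t : ℝ} (hT : 0 < T) (ht : 0 ≤ t) (x : X) :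
    |avg P (act P ψ t) T x - avg P ψ T x| ≤ T⁻¹ * (2 * C * t) := by
  rw [hm.avg_act hψ hC hT ht, avg, ← mul_sub, abs_mul, abs_inv, abs_of_pos hT]
  gcongr
  have hi := hm.intervalIntegrable_act hψ hC x
  rw [intervalIntegral.integral_comp_add_right (fun s => act P ψ s x) t, zero_add,
    ← intervalIntegral.integral_interval_sub_left (hi 0 (T + t)) (hi 0 t),
    ← intervalIntegral.integral_add_adjacent_intervals (hi 0 T) (hi T (T + t))]
  have h1 := abs_intervalIntegral_le (a := T) (b := T + t) (fun s => hm.abs_act_le hC s x)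
    (by linarith)
  have h2 := abs_intervalIntegral_le (a := 0) (b := t) (fun s => hm.abs_act_le hC s x) ht
  rw [abs_le] at *
  constructor <;> linarith

theorem abs_act_avg_sub_avg_le (hm : IsMeasurableSemigroup P) {ψ : X → ℝ} {C : ℝ}
    (hψ : Measurable ψ) (hC : ∀ x, |ψ x| ≤ C) {T t : ℝ} (hT : 0 < T) (ht : 0 ≤ t) (x : X) :
    |act P (avg P ψ T) t x - avg P ψ T x| ≤ T⁻¹ * (2 * C * t) := by
  rw [hm.act_avg hψ hC hT ht, ← hm.avg_act hψ hC hT ht]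
  exact hm.abs_avg_act_sub_avg_le hψ hC hT ht x

end IsMeasurableSemigroup

end Measurability

/-! ### Squares of harmonic functions -/

section Liouville

variable {X : Type*} [MeasurableSpace X] {P : ℝ≥0 → Kernel X X}

theorem integral_sub_const_sq {μ : Measure X} [IsProbabilityMeasure μ] {f : X → ℝ} {C : ℝ}
    (hf : Measurable f) (hC : ∀ x, |f x| ≤ C) (a : ℝ) :
    ∫ x, (f x - a) ^ 2 ∂μ = ∫ x, f x ^ 2 ∂μ - 2 * a * ∫ x, f x ∂μ + a ^ 2 := by
  have hi : Integrable f μ := integrable_of_bound hf hC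
  have hi2 : Integrable (fun x => f x ^ 2) μ := integrable_of_bound (C := C ^ 2) (hf.pow_const 2)
    fun x => by rw [abs_pow]; gcongr; exact hC x
  have : ∀ x, (f x - a) ^ 2 = f x ^ 2 - 2 * a * f x + a ^ 2 := fun x => by ring
  simp_rw [this]
  rw [integral_add (by fun_prop) (by fun_prop), integral_sub hi2 (by fun_prop),
    integral_const_mul]
  simp

namespace IsMeasurableSemigroup

theorem act_mono (hm : IsMeasurableSemigroup P) {f g : X → ℝ} {C D : ℝ}
    (hf : Measurable f) (hC : ∀ x, |f x| ≤ C) (hg : Measurable g) (hD : ∀ x, |g x| ≤ D)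
    (h : ∀ x, f x ≤ g x) (s : ℝ) (x : X) : act P f s x ≤ act P g s x := by
  have := hm.markov
  exact integral_mono (integrable_of_bound hf hC) (integrable_of_bound hg hD) h

/-- The square of a bounded harmonic function `f` has a bounded superharmonic majorant `h` for
which the time averages of `h - f ^ 2` vanish in the limit. -/
theorem exists_majorant_sq (hm : IsMeasurableSemigroup P) {f : X → ℝ} {C : ℝ}
    (hf : Measurable f) (hC : ∀ x, |f x| ≤ C) (hinv : ∀ s, 0 ≤ s → ∀ x, act P f s x = f x) :
    ∃ h : X → ℝ, Measurable h ∧ (∀ x, |h x| ≤ C ^ 2) ∧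
      (∀ T, 0 < T → ∀ x, avg P (fun y => f y ^ 2) T x ≤ h x) ∧
      ∀ x, ∀ ε > 0, ∀ᶠ T in atTop, avg P h T x - avg P (fun y => f y ^ 2) T x ≤ ε := by
  have := hm.markov
  set g : X → ℝ := fun y => f y ^ 2 with hg
  have hgm : Measurable g := hf.pow_const 2
  have hgC : ∀ x, |g x| ≤ C ^ 2 := fun x => by
    rw [hg, abs_pow]; gcongr; exact hC x
  have hg0 : ∀ x, 0 ≤ g x := fun x => sq_nonneg _
  have hv : ∀ s x, |act P g s x| ≤ C ^ 2 := hm.abs_act_le hgC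
  have hvm : ∀ s, Measurable (act P g s) := hm.measurable_act_right hgm
  have hv0 : ∀ s x, 0 ≤ act P g s x := fun s x => integral_nonneg hg0
  -- Harmonicity makes `f x` the mean of `f` under `P_s(x, ·)`, so the difference of the two sides
  -- is a variance.
  have h1 : ∀ s, 0 ≤ s → ∀ x, g x ≤ act P g s x := by
    intro s hs x
    have h := integral_sub_const_sq (μ := P s.toNNReal x) hf hC (f x)
    have h' : ∫ y, f y ∂(P s.toNNReal x) = f x := hinv s hs x
    have h'' : 0 ≤ ∫ y, (f y - f x) ^ 2 ∂(P s.toNNReal x) :=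
      integral_nonneg fun y => sq_nonneg _
    rw [h'] at h
    change f x ^ 2 ≤ ∫ y, f y ^ 2 ∂(P s.toNNReal x)
    linarith [sq (f x)]
  have hmono : ∀ s t, 0 ≤ s → s ≤ t → ∀ x, act P g s x ≤ act P g t x := by
    intro s t hs hst x
    have e : t = s + (t - s) := by ring
    rw [e, hm.act_add hgm hgC hs (by linarith)]
    exact hm.act_mono hgm hgC (hvm _) (hv _) (h1 _ (by linarith)) s x
  have hbdd : ∀ x, BddAbove (Set.range fun n : ℕ => act P g n x) := fun x =>
    ⟨C ^ 2, by rintro _ ⟨n, rfl⟩; exact (le_abs_self _).trans (hv _ _)⟩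
  set h : X → ℝ := fun x => ⨆ n : ℕ, act P g n x with hh
  have hlim : ∀ x, Tendsto (fun n : ℕ => act P g n x) atTop (𝓝 (h x)) := fun x =>
    tendsto_atTop_ciSup (fun m n hmn => hmono _ _ (by positivity) (by exact_mod_cast hmn) x)
      (hbdd x)
  have hle : ∀ s, 0 ≤ s → ∀ x, act P g s x ≤ h x := fun s hs x =>
    (hmono s ⌈s⌉₊ hs (Nat.le_ceil s) x).trans (le_ciSup (hbdd x) ⌈s⌉₊)
  have hhm : Measurable h := measurable_of_tendsto_metrizable (fun n : ℕ => hvm n)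
    (tendsto_pi_nhds.2 hlim)
  have hhC : ∀ x, |h x| ≤ C ^ 2 := fun x =>
    le_of_tendsto' (hlim x).abs fun n => hv _ _
  have hsup : ∀ s, 0 ≤ s → ∀ x, act P h s x ≤ h x := by
    intro s hs x
    have hd : Tendsto (fun n : ℕ => act P (act P g n) s x) atTop (𝓝 (act P h s x)) :=
      tendsto_integral_of_dominated_convergence (fun _ => C ^ 2)
        (fun n => (hvm n).aestronglyMeasurable) (integrable_const _)
        (fun n => ae_of_all _ fun y => hv _ _) (ae_of_all _ hlim)
    refine le_of_tendsto' hd fun n => ?_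
    rw [← hm.act_add hgm hgC hs (by positivity)]
    exact hle _ (by positivity) x
  refine ⟨h, hhm, hhC, fun T hT x => ?_, fun x ε hε => ?_⟩
  · rw [avg, inv_mul_le_iff₀ hT]
    have := intervalIntegral.integral_mono_on hT.le (hm.intervalIntegrable_act hgm hgC x 0 T)
      (intervalIntegrable_const (c := h x)) fun s hs => hle s hs.1 x
    simpa using this
  -- By monotonicity, once time `n` brings `P_n (f ^ 2)` close to `h` at `x`, only the window `[0,
  -- n]` is lost, which costs at most `n * C ^ 2 / T` in the average.
  · obtain ⟨n, hn⟩ := ((hlim x).eventually (lt_mem_nhds (show h x - ε / 2 < h x by linarith))).exists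
    have hev : ∀ᶠ T : ℝ in atTop, T⁻¹ * (n * C ^ 2) ≤ ε / 2 := by
      have : Tendsto (fun T : ℝ => T⁻¹ * (n * C ^ 2)) atTop (𝓝 (0 * (n * C ^ 2))) :=
        tendsto_inv_atTop_zero.mul_const _
      rw [zero_mul] at this
      exact (this.eventually (gt_mem_nhds (half_pos hε))).mono fun T h => h.le
    filter_upwards [hev, eventually_gt_atTop (n : ℝ), eventually_gt_atTop 0] with T h2 hT hT0
    have hA : avg P h T x ≤ h x := by
      rw [avg, inv_mul_le_iff₀ hT0]
      have := intervalIntegral.integral_mono_on hT0.le (hm.intervalIntegrable_act hhm hhC x 0 T)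
        (intervalIntegrable_const (c := h x)) fun s hs => hsup s hs.1 x
      simpa using this
    have hi := hm.intervalIntegrable_act hgm hgC x
    have hB : (T - n) * act P g n x ≤ ∫ s in (0 : ℝ)..T, act P g s x := by
      rw [← intervalIntegral.integral_add_adjacent_intervals (hi 0 n) (hi n T)]
      have k1 : 0 ≤ ∫ s in (0 : ℝ)..n, act P g s x :=
        intervalIntegral.integral_nonneg (by positivity) fun s _ => hv0 s x
      have k2 := intervalIntegral.integral_mono_on hT.le
        (intervalIntegrable_const (c := act P g n x)) (hi n T)
        fun s hs => hmono n s (by positivity) hs.1 x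
      simp only [intervalIntegral.integral_const, smul_eq_mul] at k2
      linarith
    have hC' : act P g n x - T⁻¹ * (n * C ^ 2) ≤ avg P g T x := by
      rw [avg]
      calc act P g n x - T⁻¹ * (n * C ^ 2) ≤ act P g n x - T⁻¹ * (n * act P g n x) := by
            gcongr
            exact (le_abs_self _).trans (hv _ _)
        _ = T⁻¹ * ((T - n) * act P g n x) := by field_simp
        _ ≤ _ := by gcongr
    linarith

end IsMeasurableSemigroup

end Liouville

/-! ### Bounded continuous harmonic functions are constant -/

section LiouvilleMetric

variable {X : Type*} [MetricSpace X] [MeasurableSpace X] [BorelSpace X] {P : ℝ≥0 → Kernel X X}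

/-- A continuous bounded harmonic function is constant. -/
theorem IsMeasurableSemigroup.eq_of_invariant (hm : IsMeasurableSemigroup P) {z : X}
    (hUnif : ∀ A : Set X, Bornology.IsBounded A → ∀ δ : ℝ, 0 < δ →
      0 < ⨅ x ∈ A, liminf (fun T : ℝ => timeAverageAt P T x (Metric.ball z δ)) atTop)
    (hConc : ∀ ε : ℝ, 0 < ε → ∀ x : X, ∃ D : Set X, Bornology.IsBounded D ∧ MeasurableSet D ∧
      ENNReal.ofReal (1 - ε) < liminf (fun T : ℝ => timeAverageAt P T x D) atTop)
    {f : X → ℝ} {C : ℝ} (hf : Continuous f) (hC : ∀ x, |f x| ≤ C)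
    (hinv : ∀ s, 0 ≤ s → ∀ x, act P f s x = f x) (x : X) : f x = f z := by
  have hP : ∀ {T : ℝ}, 0 < T → ∀ y, IsProbabilityMeasure (timeAverageAt P T y) := fun hT y =>
    hm.isProbabilityMeasure_timeAverage _ hT
  obtain ⟨h, hhm, hhC, hle, hlim⟩ := hm.exists_majorant_sq hf.measurable hC hinv
  have hC0 : 0 ≤ C := (abs_nonneg _).trans (hC z)
  have hfm := hf.measurable
  have hfavg : ∀ T, 0 < T → ∀ y, avg P f T y = f y := by
    intro T hT y
    rw [avg, intervalIntegral.integral_congr (g := fun _ => f y)]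
    · simp [hT.ne']
    · intro s hs
      rw [Set.uIcc_of_le hT.le] at hs
      exact hinv s hs.1 y
  have hg2 : Measurable fun y => f y ^ 2 := hfm.pow_const 2
  have hg2C : ∀ y, |f y ^ 2| ≤ C ^ 2 := fun y => by rw [abs_pow]; gcongr; exact hC y
  have key : ∀ η > 0, ∀ ε > 0, |f x - f z| ≤ 2 * η + 2 * C * ε + ε := by
    intro η hη ε hε
    obtain ⟨δ, hδ, hball⟩ := Metric.continuousAt_iff.1 (hf.continuousAt (x := z)) η hη
    obtain ⟨D, hDb, hDm, hD⟩ := hConc ε hε x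
    obtain ⟨a, ha0, ha⟩ := ENNReal.lt_iff_exists_nnreal_btwn.1 (hUnif D hDb δ hδ)
    have ha0' : 0 < a := by exact_mod_cast ha0
    -- On the ball `f` is within `η` of `f z`, hence at least `η` away from `f y`. The mass `a` of
    -- the ball then gives variance at least `a * η ^ 2`, and `h - f ^ 2` dominates the variance.
    have hlow : ∀ y ∈ D, 2 * η ≤ |f y - f z| → a * η ^ 2 ≤ h y - f y ^ 2 := by
      intro y hy hyz
      have h1 := ha.trans_le (iInf₂_le y hy)
      obtain ⟨T, hT, hT0⟩ := ((eventually_lt_of_lt_liminf h1).and (eventually_gt_atTop 0)).exists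
      have := hP hT0 y
      have h2 := integral_sub_const_sq (μ := timeAverageAt P T y) hfm hC (f y)
      rw [hm.integral_timeAverageAt y hg2 hg2C hT0, hm.integral_timeAverageAt y hfm hC hT0,
        hfavg T hT0] at h2
      have h3 := hle T hT0 y
      have h4 : (timeAverageAt P T y).real (Metric.ball z δ) * η ^ 2 ≤
          ∫ w, (f w - f y) ^ 2 ∂(timeAverageAt P T y) := by
        rw [← smul_eq_mul, ← integral_indicator_const _ Metric.isOpen_ball.measurableSet]
        refine integral_mono ((integrable_const _).indicator Metric.isOpen_ball.measurableSet)
          (integrable_of_bound (C := (2 * C) ^ 2) ((hfm.sub_const _).pow_const 2) fun w => ?_)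
          fun w => ?_
        · rw [abs_pow]
          gcongr
          exact (abs_sub _ _).trans (by linarith [hC w, hC y])
        · by_cases hw : w ∈ Metric.ball z δ
          · rw [Set.indicator_of_mem hw, ← sq_abs (f w - f y)]
            gcongr
            have := hball hw
            rw [Real.dist_eq] at this
            have := abs_sub_abs_le_abs_sub (f y - f z) (f w - f z)
            rw [sub_sub_sub_cancel_right, abs_sub_comm (f y) (f w)] at this
            linarith
          · rw [Set.indicator_of_notMem hw]
            positivity
      have h5 : (a : ℝ) ≤ (timeAverageAt P T y).real (Metric.ball z δ) := by
        have := ENNReal.toReal_mono (measure_ne_top _ _) hT.le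
        rwa [ENNReal.coe_toReal] at this
      have h6 : (a : ℝ) * η ^ 2 ≤ (timeAverageAt P T y).real (Metric.ball z δ) * η ^ 2 := by
        gcongr
      nlinarith
    have hnn : ∀ y, 0 ≤ h y - f y ^ 2 := by
      intro y
      have hT0 : (0 : ℝ) < 1 := one_pos
      have := hP hT0 y
      have h2 := integral_sub_const_sq (μ := timeAverageAt P 1 y) hfm hC (f y)
      rw [hm.integral_timeAverageAt y hg2 hg2C hT0, hm.integral_timeAverageAt y hfm hC hT0,
        hfavg 1 hT0] at h2
      have h3 := hle 1 hT0 y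
      have h4 : 0 ≤ ∫ w, (f w - f y) ^ 2 ∂(timeAverageAt P 1 y) :=
        integral_nonneg fun w => sq_nonneg _
      nlinarith
    -- With this `M`, the lower bound on `h - f ^ 2` becomes `2 * C`, the trivial bound for `|f y -
    -- f z|`.
    set M : ℝ := 2 * C / (a * η ^ 2) with hM
    have hM0 : 0 ≤ M := by positivity
    have hpt : ∀ y, |f y - f z| ≤ 2 * η + M * (h y - f y ^ 2) + Dᶜ.indicator (fun _ => 2 * C) y := by
      intro y
      have hb : |f y - f z| ≤ 2 * C := (abs_sub _ _).trans (by linarith [hC y, hC z])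
      have hp : 0 ≤ M * (h y - f y ^ 2) := mul_nonneg hM0 (hnn y)
      by_cases hy : y ∈ D
      · rw [Set.indicator_of_notMem (by simpa using hy)]
        by_cases hyz : 2 * η ≤ |f y - f z|
        · have h7 : M * (a * η ^ 2) ≤ M * (h y - f y ^ 2) := by gcongr; exact hlow y hy hyz
          rw [hM, div_mul_cancel₀ _ (by positivity)] at h7
          linarith
        · linarith
      · rw [Set.indicator_of_mem (by simpa using hy)]
        linarith
    -- Dividing by `M + 1` instead of `M` covers the case `C = 0`, where `M` vanishes.
    obtain ⟨T, ⟨hTD, hT1⟩, hT0⟩ := (((eventually_lt_of_lt_liminf hD).and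
      (hlim x (ε / (M + 1)) (by positivity))).and (eventually_gt_atTop 0)).exists
    have := hP hT0 x
    set ν := timeAverageAt P T x with hν
    have hDc : ν.real Dᶜ ≤ ε := by
      rw [probReal_compl_eq_one_sub hDm]
      have : 1 - ε ≤ ν.real D := by
        rw [measureReal_def]
        exact (ENNReal.ofReal_le_iff_le_toReal (measure_ne_top _ _)).1 hTD.le
      linarith
    have hi1 : Integrable (fun y => f y - f z) ν := (integrable_of_bound hfm hC).sub
      (integrable_const _)
    have hi2 : Integrable (fun y => h y - f y ^ 2) ν :=
      (integrable_of_bound hhm hhC).sub (integrable_of_bound hg2 hg2C)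
    have hi3 : Integrable (Dᶜ.indicator fun _ => 2 * C) ν := (integrable_const _).indicator hDm.compl
    have hi4 : Integrable (fun y => 2 * η + M * (h y - f y ^ 2)) ν :=
      (integrable_const _).add (hi2.const_mul M)
    have hi5 : Integrable (fun y => 2 * η + M * (h y - f y ^ 2) +
        Dᶜ.indicator (fun _ => 2 * C) y) ν := hi4.add hi3
    calc |f x - f z| = |∫ y, (f y - f z) ∂ν| := by
          rw [integral_sub (integrable_of_bound hfm hC) (integrable_const _),
            hm.integral_timeAverageAt x hfm hC hT0, hfavg T hT0]
          simp
      _ ≤ ∫ y, |f y - f z| ∂ν := abs_integral_le_integral_abs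
      _ ≤ ∫ y, (2 * η + M * (h y - f y ^ 2) + Dᶜ.indicator (fun _ => 2 * C) y) ∂ν :=
          integral_mono hi1.abs hi5 hpt
      _ = 2 * η + M * (avg P h T x - avg P (fun y => f y ^ 2) T x) + ν.real Dᶜ * (2 * C) := by
          rw [integral_add hi4 hi3,
            integral_add (integrable_const _) (hi2.const_mul M), integral_const_mul M,
            integral_sub (integrable_of_bound hhm hhC) (integrable_of_bound hg2 hg2C),
            integral_indicator_const _ hDm.compl, hm.integral_timeAverageAt x hhm hhC hT0,
            hm.integral_timeAverageAt x hg2 hg2C hT0]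
          simp
      _ ≤ 2 * η + M * (ε / (M + 1)) + ε * (2 * C) := by gcongr
      _ ≤ 2 * η + 2 * C * ε + ε := by
          have : M * (ε / (M + 1)) ≤ ε := by
            rw [mul_div_assoc', div_le_iff₀ (by positivity)]
            nlinarith
          linarith
  have h0 : |f x - f z| ≤ 0 := by
    refine le_of_forall_pos_le_add fun e he => ?_
    refine (key (e / 4) (by positivity) (e / (2 * (2 * C + 1))) (by positivity)).trans ?_
    have : 2 * C * (e / (2 * (2 * C + 1))) + e / (2 * (2 * C + 1)) = e / 2 := by
      field_simp
    linarith
  exact sub_eq_zero.1 (abs_eq_zero.1 (le_antisymm h0 (abs_nonneg _)))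

end LiouvilleMetric

/-! ### Tightness of the time averages at one point -/

section Tightness

variable {X : Type*} [MetricSpace X] [MeasurableSpace X]

/-- A family of measures is tight as soon as, for every radius, finitely many balls of that radius
carry almost all the mass uniformly over the family. -/
theorem isTightMeasureSet_of_finite_cover [CompleteSpace X] {S : Set (Measure X)}
    (h : ∀ ε : ℝ, 0 < ε → ∀ r : ℝ, 0 < r → ∃ F : Finset X, ∀ μ ∈ S,
      μ (⋃ a ∈ F, Metric.closedBall a r)ᶜ ≤ ENNReal.ofReal ε) : IsTightMeasureSet S := by
  rw [isTightMeasureSet_iff_exists_isCompact_measure_compl_le]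
  intro ε hε
  obtain ⟨e, he0, he⟩ := ENNReal.exists_pos_sum_of_countable hε.ne' ℕ
  choose F hF using fun n : ℕ => h (e n) (by exact_mod_cast he0 n) (1 / ((n : ℝ) + 1))
    (by positivity)
  refine ⟨⋂ n, ⋃ a ∈ F n, Metric.closedBall a (1 / ((n : ℝ) + 1)), ?_, fun μ hμ => ?_⟩
  · refine isCompact_iff_totallyBounded_isComplete.2 ⟨?_, IsClosed.isComplete ?_⟩
    · refine Metric.totallyBounded_iff.2 fun r hr => ?_
      obtain ⟨n, hn⟩ := exists_nat_one_div_lt hr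
      refine ⟨F n, (F n).finite_toSet, (Set.iInter_subset _ n).trans ?_⟩
      refine Set.iUnion₂_mono fun a _ => Metric.closedBall_subset_ball hn
    · exact isClosed_iInter fun n => (F n).finite_toSet.isClosed_biUnion
        fun a _ => Metric.isClosed_closedBall
  · rw [Set.compl_iInter]
    refine (measure_iUnion_le _).trans (le_trans ?_ he.le)
    refine ENNReal.tsum_le_tsum fun n => ?_
    simpa using hF n μ hμ

/-- A family of measures that is not tight charges a sequence of uniformly separated finite unions
of balls. -/
theorem exists_separated_of_not_isTightMeasureSet [CompleteSpace X]
    [TopologicalSpace.SeparableSpace X] {S : Set (Measure X)} (h : ¬ IsTightMeasureSet S) :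
    ∃ ε > 0, ∃ r > 0, ∃ G : ℕ → Finset X,
      (∀ n, ∃ μ ∈ S, ENNReal.ofReal ε < μ (⋃ a ∈ G n, Metric.ball a r)) ∧
      ∀ m n, m < n → ∀ a ∈ G m, ∀ b ∈ G n, 4 * r < dist a b := by
  classical
  have h' := mt isTightMeasureSet_of_finite_cover h
  push Not at h'
  obtain ⟨ε, hε, r, hr, hS⟩ := h'
  -- The cover fails at radius `r`. Balls of radius `r / 8` leave room for new centres at distance
  -- more than `r / 2 = 4 * (r / 8)` from all earlier ones.
  refine ⟨ε, hε, r / 8, by positivity, ?_⟩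
  refine exists_seq_of_forall_finset_exists
    (fun G : Finset X => ∃ μ ∈ S, ENNReal.ofReal ε < μ (⋃ a ∈ G, Metric.ball a (r / 8)))
    (fun G H : Finset X => ∀ a ∈ G, ∀ b ∈ H, 4 * (r / 8) < dist a b) fun s _ => ?_
  obtain ⟨μ, hμ, hlt⟩ := hS (s.biUnion id)
  set U : Set X := (⋃ a ∈ s.biUnion id, Metric.closedBall a r)ᶜ with hU
  have : Nonempty X := by
    by_contra hne
    rw [not_nonempty_iff] at hne
    rw [Set.eq_empty_of_isEmpty U, measure_empty] at hlt
    exact not_lt_bot hlt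
  let d := TopologicalSpace.denseSeq X
  -- Continuity from below replaces the uncovered set `U` by the part of it in finitely many small
  -- balls around points of a dense sequence.
  let V : ℕ → Set X := fun N => U ∩ ⋃ k ∈ Finset.range N, Metric.ball (d k) (r / 8)
  have hVmono : Monotone V := fun M N hMN => Set.inter_subset_inter_right _
    (Set.biUnion_subset_biUnion_left fun k hk => by
      simp only [Finset.coe_range, Set.mem_Iio] at hk ⊢; omega)
  have hVU : ⋃ N, V N = U := by
    refine Set.Subset.antisymm (Set.iUnion_subset fun N => Set.inter_subset_left) fun y hy => ?_
    obtain ⟨k, hk⟩ := (TopologicalSpace.denseRange_denseSeq X).exists_dist_lt y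
      (show 0 < r / 8 by positivity)
    exact Set.mem_iUnion.2 ⟨k + 1, hy, Set.mem_biUnion (by simp) (Metric.mem_ball.2 hk)⟩
  have hlim := tendsto_measure_iUnion_atTop (μ := μ) hVmono
  rw [hVU] at hlim
  obtain ⟨N, hN⟩ := (hlim.eventually (lt_mem_nhds hlt)).exists
  -- Discarding centres close to old ones loses nothing: a ball of radius `r / 8` around such a
  -- centre lies within `r` of an old centre and misses `U`.
  refine ⟨((Finset.range N).image d).filter fun b => ∀ a ∈ s.biUnion id, r / 2 < dist a b,
    ⟨μ, hμ, hN.trans_le (measure_mono ?_)⟩, fun G hG a ha b hb => ?_⟩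
  · rintro y ⟨hy, hyV⟩
    simp only [Set.mem_iUnion] at hyV
    obtain ⟨k, hk, hyk⟩ := hyV
    refine Set.mem_biUnion (x := d k) ?_ hyk
    simp only [Finset.coe_filter, Set.mem_ofPred_eq]
    refine ⟨Finset.mem_image_of_mem _ hk, fun a ha => ?_⟩
    by_contra hcon
    refine hy (Set.mem_biUnion ha ?_)
    rw [Metric.mem_closedBall]
    have := dist_triangle_right y a (d k)
    rw [Metric.mem_ball] at hyk
    linarith
  · have := (Finset.mem_filter.1 hb).2 a (Finset.mem_biUnion.2 ⟨G, hG, ha⟩)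
    linarith

variable [BorelSpace X] {P : ℝ≥0 → Kernel X X}

/-- For uniformly Lipschitz functions `g n` with disjoint supports, the e-property at a point holds
uniformly in all large `n`: this follows by Baire's theorem applied to the sums of the `g n` over
all sets of indices. -/
theorem EProperty.exists_uniform (hE : EProperty P) (hP : IsTransitionSemigroup P)
    {g : ℕ → X → ℝ} {K : ℝ≥0} (hLip : ∀ n, LipschitzWith K (g n)) (h0 : ∀ n y, 0 ≤ g n y)
    (h1 : ∀ n y, g n y ≤ 1) (hdisj : ∀ m n, m ≠ n → ∀ y, g m y = 0 ∨ g n y = 0) (z : X)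
    {η : ℝ} (hη : 0 < η) :
    ∃ δ > 0, ∃ N, ∀ n ≥ N, ∀ y ∈ Metric.ball z δ, ∀ t : ℝ≥0,
      |∫ w, g n w ∂(P t z) - ∫ w, g n w ∂(P t y)| ≤ η := by
  have hmk := hP.markov
  have hι : ∀ y, ∃ i, ∀ j, j ≠ i → g j y = 0 := by
    intro y
    by_cases h : ∃ i, g i y ≠ 0
    · obtain ⟨i, hi⟩ := h
      exact ⟨i, fun j hj => (hdisj j i hj y).resolve_right hi⟩
    · push Not at h
      exact ⟨0, fun j _ => h j⟩
  choose ι hι using hι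
  -- This is the sum of the `g n` over the indices selected by `b`; at each point only the term `ι
  -- y` can be nonzero, so the Lipschitz constant stays `K`.
  let f : (ℕ → Bool) → X → ℝ := fun b y => if b (ι y) then g (ι y) y else 0
  have hf0 : ∀ b y, 0 ≤ f b y := fun b y => by
    simp only [f]; split_ifs <;> simp [h0]
  have hf1 : ∀ b y, |f b y| ≤ 1 := fun b y => by
    rw [abs_of_nonneg (hf0 b y)]
    simp only [f]; split_ifs <;> simp [h1]
  have hfL : ∀ b, LipschitzWith K (f b) := fun b => LipschitzWith.of_le_add_mul K fun x y => by
    by_cases hb : b (ι x)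
    · have e : f b x = g (ι x) x := by simp [f, hb]
      have h2 : g (ι x) y ≤ f b y := by
        by_cases hxy : ι x = ι y
        · simp [f, ← hxy, hb]
        · rw [hι y _ hxy]; exact hf0 b y
      rw [e]
      exact ((hLip (ι x)).le_add_mul x y).trans (by linarith)
    · have e : f b x = 0 := by simp [f, hb]
      rw [e]
      have := hf0 b y
      positivity
  have hfi : ∀ b (t : ℝ≥0) y, Integrable (f b) (P t y) := fun b t y =>
    integrable_of_bound (hfL b).continuous.measurable (hf1 b)
  have hcont : ∀ (t : ℝ≥0) y, Continuous fun b => ∫ w, f b w ∂(P t y) := fun t y => by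
    refine continuous_of_dominated (bound := fun _ => 1)
      (fun b => (hfL b).continuous.measurable.aestronglyMeasurable)
      (fun b => ae_of_all _ (hf1 b)) (integrable_const _) (ae_of_all _ fun w => ?_)
    exact (continuous_of_discreteTopology (f := fun c : Bool => if c then g (ι w) w else 0)).comp
      (continuous_apply (ι w))
  -- The e-property of each `f b` says that these closed sets cover the product space, so one of
  -- them has interior.
  let E : ℕ → Set (ℕ → Bool) := fun k => {b | ∀ y ∈ Metric.ball z (1 / ((k : ℝ) + 1)), ∀ t : ℝ≥0,
      |∫ w, f b w ∂(P t z) - ∫ w, f b w ∂(P t y)| ≤ η / 2}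
  have hEc : ∀ k, IsClosed (E k) := fun k => by
    simp only [E, Set.ofPred_forall]
    exact isClosed_iInter fun y => isClosed_iInter fun _ => isClosed_iInter fun t =>
      isClosed_le ((hcont t z).sub (hcont t y)).abs continuous_const
  have hEu : ⋃ k, E k = Set.univ := by
    refine Set.eq_univ_of_forall fun b => ?_
    obtain ⟨δ, hδ, h⟩ := hE (f b) ⟨⟨K, hfL b⟩, 1, hf1 b⟩ z (η / 2) (half_pos hη)
    obtain ⟨k, hk⟩ := exists_nat_one_div_lt hδ
    exact Set.mem_iUnion.2 ⟨k, fun y hy t => (h y (Metric.ball_subset_ball hk.le hy) t).le⟩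
  obtain ⟨k, b, hb⟩ := nonempty_interior_of_iUnion_of_closed hEc hEu
  -- Changing a coordinate of large index is a small move in the product topology, so both
  -- modifications of `b` stay in `E k`; the two sums differ by exactly `g n`.
  have hupd : ∀ c : Bool, ∀ᶠ n in atTop, Function.update b n c ∈ E k := fun c => by
    have : Tendsto (fun n => Function.update b n c) atTop (𝓝 b) := by
      refine tendsto_pi_nhds.2 fun i => tendsto_const_nhds.congr' ?_
      filter_upwards [eventually_gt_atTop i] with n hn
      rw [Function.update_of_ne hn.ne]
    exact (this.eventually (isOpen_interior.mem_nhds hb)).mono fun n h => interior_subset h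
  obtain ⟨N, hN⟩ := eventually_atTop.1 ((hupd true).and (hupd false))
  refine ⟨1 / ((k : ℝ) + 1), by positivity, N, fun n hn y hy t => ?_⟩
  have hg : ∀ x, ∫ w, g n w ∂(P t x) = ∫ w, f (Function.update b n true) w ∂(P t x) -
      ∫ w, f (Function.update b n false) w ∂(P t x) := fun x => by
    rw [← integral_sub (hfi _ t x) (hfi _ t x)]
    refine integral_congr_ae (ae_of_all _ fun w => ?_)
    by_cases hw : n = ι w
    · subst hw
      simp [f]
    · simp [f, Function.update_of_ne (Ne.symm hw), hι w n hw]
  have k1 := (hN n hn).1 y hy t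
  have k2 := (hN n hn).2 y hy t
  rw [hg, hg]
  rw [abs_le] at *
  constructor <;> linarith

/-- Under the e-property, the time averages started at `z` are tight if they charge every ball
around `z` in the limit. -/
theorem isTightMeasureSet_timeAverageAt [CompleteSpace X] [TopologicalSpace.SeparableSpace X]
    (hm : IsMeasurableSemigroup P) (hE : EProperty P) {z : X}
    (hlow : ∀ δ : ℝ, 0 < δ →
      0 < liminf (fun T : ℝ => timeAverageAt P T z (Metric.ball z δ)) atTop) :
    IsTightMeasureSet {ν : Measure X | ∃ T : ℝ, 0 < T ∧ ν = timeAverageAt P T z} := by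
  by_contra hcon
  obtain ⟨ε, hε, r, hr, G, hG, hsep⟩ := exists_separated_of_not_isTightMeasureSet hcon
  have hmk := hm.markov
  have hQ : ∀ {T : ℝ}, 0 < T → ∀ y, IsProbabilityMeasure (timeAverageAt P T y) := fun hT y =>
    hm.isProbabilityMeasure_timeAverage _ hT
  let A : ℕ → Set X := fun n => ⋃ a ∈ G n, Metric.ball a r
  let g : ℕ → X → ℝ := fun n y => (thickenedIndicator hr (A n) y : ℝ)
  have hg0 : ∀ n y, 0 ≤ g n y := fun n y => NNReal.coe_nonneg _
  have hg1 : ∀ n y, g n y ≤ 1 := fun n y => by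
    exact_mod_cast thickenedIndicator_le_one hr (A n) y
  have hgb : ∀ n y, |g n y| ≤ 1 := fun n y => by rw [abs_of_nonneg (hg0 n y)]; exact hg1 n y
  have hgL : ∀ n, LipschitzWith r.toNNReal⁻¹ (g n) := fun n =>
    (lipschitzWith_thickenedIndicator hr (A n))
  have hgm : ∀ n, Measurable (g n) := fun n => (hgL n).continuous.measurable
  have hsupp : ∀ n y, g n y ≠ 0 → ∃ a ∈ G n, dist y a < 2 * r := by
    intro n y hy
    by_contra hno
    push Not at hno
    refine hy ?_
    have : y ∉ Metric.thickening r (A n) := by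
      rw [Metric.mem_thickening_iff]
      rintro ⟨w, hw, hyw⟩
      simp only [A, Set.mem_iUnion, Metric.mem_ball] at hw
      obtain ⟨a, ha, hwa⟩ := hw
      have := hno a ha
      have := dist_triangle y w a
      linarith
    simp only [g, thickenedIndicator_zero hr (A n) this, NNReal.coe_zero]
  have hdisj' : ∀ m n, m < n → ∀ y, g m y = 0 ∨ g n y = 0 := by
    intro m n hmn y
    by_contra! hy
    obtain ⟨a, ha, hya⟩ := hsupp m y hy.1
    obtain ⟨b, hb, hyb⟩ := hsupp n y hy.2
    have := hsep m n hmn a ha b hb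
    have := dist_triangle_left a b y
    linarith
  have hdisj : ∀ m n, m ≠ n → ∀ y, g m y = 0 ∨ g n y = 0 := fun m n hmn y =>
    hmn.lt_or_gt.elim (fun h => hdisj' m n h y) fun h => (hdisj' n m h y).symm
  -- A time average exceeding `ε` forces the integrand to reach `ε` at some time.
  have ht : ∀ n, ∃ t, 0 ≤ t ∧ ε ≤ act P (g n) t z := by
    intro n
    obtain ⟨_, ⟨T, hT, rfl⟩, hlt⟩ := hG n
    have := hQ hT z
    have hAm : MeasurableSet (A n) := (isOpen_biUnion fun a _ => Metric.isOpen_ball).measurableSet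
    have h1 : ε < avg P (g n) T z := by
      rw [← hm.integral_timeAverageAt z (hgm n) (hgb n) hT]
      have h2 : ε < (timeAverageAt P T z).real (A n) :=
        (ENNReal.ofReal_lt_iff_lt_toReal hε.le (measure_ne_top _ _)).1 hlt
      refine h2.trans_le ?_
      rw [← integral_indicator_one hAm]
      refine integral_mono ((integrable_const _).indicator hAm)
        (integrable_of_bound (hgm n) (hgb n)) fun y => ?_
      by_cases hy : y ∈ A n
      · rw [Set.indicator_of_mem hy]
        simp only [g, thickenedIndicator_one hr (A n) hy, Pi.one_apply, NNReal.coe_one, le_refl]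
      · simp [hy, hg0]
    by_contra! hno
    have h2 := intervalIntegral.integral_mono_on hT.le
      (hm.intervalIntegrable_act (hgm n) (hgb n) z 0 T) (intervalIntegrable_const (c := ε))
      fun s hs => (hno s hs.1).le
    rw [avg, lt_inv_mul_iff₀ hT] at h1
    simp only [intervalIntegral.integral_const, smul_eq_mul, sub_zero] at h2
    linarith
  choose t ht0 ht using ht
  obtain ⟨δ, hδ, N, hN⟩ := hE.exists_uniform hm.toIsTransitionSemigroup hgL hg0 hg1 hdisj z
    (half_pos hε)
  obtain ⟨a, ha0, ha⟩ := ENNReal.lt_iff_exists_nnreal_btwn.1 (hlow δ hδ)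
  have ha0' : 0 < a := by exact_mod_cast ha0
  have hBm : MeasurableSet (Metric.ball z δ) := Metric.isOpen_ball.measurableSet
  -- The average of `P_{t n} (g n)` is at least `a * ε / 2`, since this function is at least `ε / 2`
  -- on the ball; replacing it by `g n` costs at most half of that for large `T`.
  have hev : ∀ n ≥ N, ∀ᶠ T in atTop, a * ε / 4 ≤ avg P (g n) T z := by
    intro n hn
    have h2 : ∀ᶠ T : ℝ in atTop, T⁻¹ * (2 * 1 * t n) < a * ε / 4 := by
      have : Tendsto (fun T : ℝ => T⁻¹ * (2 * 1 * t n)) atTop (𝓝 (0 * (2 * 1 * t n))) :=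
        tendsto_inv_atTop_zero.mul_const _
      rw [zero_mul] at this
      exact this.eventually (gt_mem_nhds (by positivity))
    filter_upwards [h2, eventually_lt_of_lt_liminf ha, eventually_gt_atTop 0] with T h2 h3 hT
    have := hQ hT z
    have h4 := hm.abs_avg_act_sub_avg_le (hgm n) (hgb n) hT (ht0 n) z
    have h5 : (a : ℝ) ≤ (timeAverageAt P T z).real (Metric.ball z δ) := by
      have := ENNReal.toReal_mono (measure_ne_top _ _) h3.le
      rwa [ENNReal.coe_toReal] at this
    have h6 : (timeAverageAt P T z).real (Metric.ball z δ) * (ε / 2) ≤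
        avg P (act P (g n) (t n)) T z := by
      rw [← hm.integral_timeAverageAt z (hm.measurable_act_right (hgm n) _)
        (hm.abs_act_le (hgb n) _) hT, ← smul_eq_mul, ← integral_indicator_const _ hBm]
      refine integral_mono ((integrable_const _).indicator hBm)
        (integrable_of_bound (hm.measurable_act_right (hgm n) _) (hm.abs_act_le (hgb n) _))
        fun y => ?_
      by_cases hy : y ∈ Metric.ball z δ
      · rw [Set.indicator_of_mem hy]
        have h7 : |act P (g n) (t n) z - act P (g n) (t n) y| ≤ ε / 2 :=
          hN n hn y hy (t n).toNNReal
        have := ht n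
        rw [abs_le] at h7
        linarith
      · rw [Set.indicator_of_notMem hy]
        exact integral_nonneg (hg0 n)
    have h8 : (a : ℝ) * (ε / 2) ≤ (timeAverageAt P T z).real (Metric.ball z δ) * (ε / 2) := by
      gcongr
    rw [abs_le] at h4
    linarith
  -- `M` bumps of average at least `a * ε / 4` would total more than `1`, while disjointness of
  -- supports bounds their sum by `1`.
  obtain ⟨M, hM⟩ := exists_nat_gt (1 / (a * ε / 4))
  obtain ⟨T, hTall, hT⟩ := (((Finset.Ico N (N + M)).eventually_all.2 fun n hn =>
    hev n (Finset.mem_Ico.1 hn).1).and (eventually_gt_atTop 0)).exists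
  have := hQ hT z
  have hsum : ∑ n ∈ Finset.Ico N (N + M), avg P (g n) T z ≤ 1 := by
    simp_rw [← hm.integral_timeAverageAt z (hgm _) (hgb _) hT]
    rw [← integral_finsetSum _ fun n _ => integrable_of_bound (hgm n) (hgb n)]
    have : ∀ y, |∑ n ∈ Finset.Ico N (N + M), g n y| ≤ 1 := fun y => by
      rw [abs_of_nonneg (Finset.sum_nonneg fun n _ => hg0 n y)]
      by_cases h : ∃ i ∈ Finset.Ico N (N + M), g i y ≠ 0
      · obtain ⟨i, hi, hiy⟩ := h
        rw [Finset.sum_eq_single_of_mem i hi fun j _ hj => (hdisj j i hj y).resolve_right hiy]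
        exact hg1 i y
      · push Not at h
        rw [Finset.sum_eq_zero h]
        exact zero_le_one
    exact (le_abs_self _).trans (abs_integral_le_of_bound this)
  have hcard := Finset.card_nsmul_le_sum _ _ _ hTall
  rw [Nat.card_Ico, add_tsub_cancel_left, nsmul_eq_mul] at hcard
  rw [div_lt_iff₀ (by positivity)] at hM
  linarith

end Tightness

/-! ### Invariant measures as limits of time averages -/

section Convergence

variable {X : Type*} [MeasurableSpace X] {P : ℝ≥0 → Kernel X X}

/-- `Q^T μ` as a probability measure, with the value `μ` for `T ≤ 0`. -/
noncomputable def timeAverageProb (hm : IsMeasurableSemigroup P) (μ : ProbabilityMeasure X)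
    (T : ℝ) : ProbabilityMeasure X :=
  if hT : 0 < T then ⟨timeAverage P T μ, hm.isProbabilityMeasure_timeAverage μ hT⟩ else μ

theorem coe_timeAverageProb (hm : IsMeasurableSemigroup P) (μ : ProbabilityMeasure X) {T : ℝ}
    (hT : 0 < T) : (timeAverageProb hm μ T : Measure X) = timeAverage P T μ := by
  simp [timeAverageProb, hT]

theorem tendsto_timeAverageProb_iff (hm : IsMeasurableSemigroup P) {μ : ProbabilityMeasure X}
    [TopologicalSpace X] [OpensMeasurableSpace X] {l : Filter ℝ} (hl : ∀ᶠ T in l, 0 < T)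
    {ν : ProbabilityMeasure X} :
    Tendsto (timeAverageProb hm μ) l (𝓝 ν) ↔ ∀ ψ : X →ᵇ ℝ,
      Tendsto (fun T => ∫ x, ψ x ∂(timeAverage P T μ)) l (𝓝 (∫ x, ψ x ∂ν)) := by
  rw [ProbabilityMeasure.tendsto_iff_forall_integral_tendsto]
  refine forall_congr' fun ψ => tendsto_congr' ?_
  filter_upwards [hl] with T hT
  rw [coe_timeAverageProb hm μ hT]

/-- A limit point of time averages of a Feller semigroup is invariant. -/
theorem exists_isInvariantProb [TopologicalSpace X] [T2Space X] [HasOuterApproxClosed X]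
    [BorelSpace X] (hm : IsMeasurableSemigroup P) (hF : IsFeller P) {z : X}
    (hz : z ∈ tightPoints P) : ∃ μ, IsInvariantProb P μ := by
  have hmk := hm.markov
  let δz : ProbabilityMeasure X := ⟨Measure.dirac z, inferInstance⟩
  let S : Set (ProbabilityMeasure X) := {ν | ∃ T, 0 < T ∧ ν = timeAverageProb hm δz T}
  have hS : IsTightMeasureSet {x | ∃ μ ∈ S, (μ : Measure X) = x} := by
    refine IsTightMeasureSet.subset hz ?_
    rintro _ ⟨_, ⟨T, hT, rfl⟩, rfl⟩
    exact ⟨T, hT, coe_timeAverageProb hm δz hT⟩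
  have hmem : ∀ᶠ T in atTop, timeAverageProb hm δz T ∈ closure S := by
    filter_upwards [eventually_gt_atTop 0] with T hT using subset_closure ⟨T, hT, rfl⟩
  obtain ⟨μ, -, hμ⟩ := (isCompact_closure_of_isTightMeasureSet hS).exists_mapClusterPt_of_frequently
    hmem.frequently
  -- An ultrafilter turns the cluster point given by Prokhorov's theorem into a genuine limit.
  obtain ⟨U, hU, hUμ⟩ := mapClusterPt_iff_ultrafilter.1 hμ
  have hpos : ∀ᶠ T in (U : Filter ℝ), 0 < T := hU (eventually_gt_atTop 0)
  rw [tendsto_timeAverageProb_iff hm hpos] at hUμ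
  refine ⟨μ, inferInstance, fun t => ?_⟩
  have := hm.isProbabilityMeasure_comp μ t
  refine ext_of_forall_integral_eq_of_IsFiniteMeasure fun ψ => ?_
  have hψm := ψ.continuous.measurable
  have hψb : ∀ x, |ψ x| ≤ ‖ψ‖ := ψ.norm_coe_le_norm
  let φ : X →ᵇ ℝ := BoundedContinuousFunction.ofNormedAddCommGroup (act P ψ t)
    (by
      have e : act P ψ t = fun x => ∫ y, ψ y ∂(P t x) := funext fun x => by
        rw [act, Real.toNNReal_coe]
      rw [e]
      exact hF t ψ) ‖ψ‖ (hm.abs_act_le hψb t)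
  have h1 := hUμ ψ
  have h2 := hUμ φ
  have h3 : ∫ x, ψ x ∂(P t ∘ₘ (μ : Measure X)) = ∫ x, φ x ∂(μ : Measure X) := by
    have := hm.integral_comp_eq μ hψm hψb t
    rwa [Real.toNNReal_coe] at this
  rw [h3]
  have h4 : Tendsto (fun T : ℝ => T⁻¹ * (2 * ‖ψ‖ * t)) U (𝓝 0) := by
    have := (tendsto_inv_atTop_zero (𝕜 := ℝ)).mul_const (2 * ‖ψ‖ * t)
    rw [zero_mul] at this
    exact this.mono_left hU
  have h5 : Tendsto (fun T => ∫ x, φ x ∂(timeAverage P T δz) - ∫ x, ψ x ∂(timeAverage P T δz)) U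
      (𝓝 0) := by
    refine squeeze_zero_norm' ?_ h4
    filter_upwards [hpos] with T hT
    have e1 := hm.integral_timeAverageAt z hψm hψb hT
    have e2 := hm.integral_timeAverageAt z (hm.measurable_act_right hψm t)
      (hm.abs_act_le hψb t) hT
    have := hm.abs_avg_act_sub_avg_le hψm hψb hT t.coe_nonneg z
    rw [← e1, ← e2] at this
    exact this
  exact sub_eq_zero.1 (tendsto_nhds_unique (h2.sub h1) h5)

namespace IsMeasurableSemigroup

theorem abs_avg_sub_le (hm : IsMeasurableSemigroup P) {ψ : X → ℝ} {C : ℝ} (hψ : Measurable ψ)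
    (hC : ∀ x, |ψ x| ≤ C) {x y : X} {ε : ℝ} (h : ∀ t, |act P ψ t x - act P ψ t y| ≤ ε) {T : ℝ}
    (hT : 0 < T) : |avg P ψ T x - avg P ψ T y| ≤ ε := by
  rw [avg, avg, ← mul_sub, ← intervalIntegral.integral_sub (hm.intervalIntegrable_act hψ hC x 0 T)
    (hm.intervalIntegrable_act hψ hC y 0 T), abs_mul, abs_inv, abs_of_pos hT,
    inv_mul_le_iff₀ hT]
  have := abs_intervalIntegral_le (a := 0) (b := T) h hT.le
  linarith

end IsMeasurableSemigroup

theorem IsInvariantProb.integral_act {μ : Measure X} (hμ : IsInvariantProb P μ)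
    (hm : IsMeasurableSemigroup P) {ψ : X → ℝ} {C : ℝ} (hψ : Measurable ψ)
    (hC : ∀ x, |ψ x| ≤ C) (t : ℝ) : ∫ x, act P ψ t x ∂μ = ∫ x, ψ x ∂μ := by
  have := hμ.1
  rw [← hm.integral_comp_eq μ hψ hC t, hμ.2]

theorem IsInvariantProb.integral_timeAverage {μ : Measure X} (hμ : IsInvariantProb P μ)
    (hm : IsMeasurableSemigroup P) {ψ : X → ℝ} {C : ℝ} (hψ : Measurable ψ)
    (hC : ∀ x, |ψ x| ≤ C) {T : ℝ} (hT : 0 < T) :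
    ∫ x, ψ x ∂(timeAverage P T μ) = ∫ x, ψ x ∂μ := by
  have := hμ.1
  simp [hm.integral_timeAverage' μ hψ hC hT, hμ.integral_act hm hψ hC, hT.ne']

end Convergence

/-! ### Convergence of time averages from every starting point -/

section ConvergenceMetric

variable {X : Type*} [MetricSpace X] [MeasurableSpace X] [BorelSpace X] {P : ℝ≥0 → Kernel X X}

theorem EProperty.exists_abs_avg_sub_le (hE : EProperty P) (hm : IsMeasurableSemigroup P)
    {ψ : X → ℝ} (hψ : IsLipBounded ψ) (x : X) {ε : ℝ} (hε : 0 < ε) :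
    ∃ δ > 0, ∀ y ∈ Metric.ball x δ, ∀ T, 0 < T → |avg P ψ T x - avg P ψ T y| ≤ ε := by
  obtain ⟨δ, hδ, h⟩ := hE ψ hψ x ε hε
  obtain ⟨⟨K, hK⟩, C, hC⟩ := hψ
  exact ⟨δ, hδ, fun y hy T hT => hm.abs_avg_sub_le hK.continuous.measurable hC
    (fun t => (h y hy t.toNNReal).le) hT⟩

/-- If bounded continuous harmonic functions are constant, the time averages of a bounded Lipschitz
function converge pointwise to its integral against any invariant probability measure. -/
theorem tendsto_avg [TopologicalSpace.SeparableSpace X] (hm : IsMeasurableSemigroup P)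
    (hE : EProperty P)
    (hconst : ∀ (f : X → ℝ) (C : ℝ), Continuous f → (∀ x, |f x| ≤ C) →
      (∀ s, 0 ≤ s → ∀ x, act P f s x = f x) → ∀ x y, f x = f y)
    {μ : Measure X} (hμ : IsInvariantProb P μ) {ψ : X → ℝ} (hψ : IsLipBounded ψ) (x : X) :
    Tendsto (fun T => avg P ψ T x) atTop (𝓝 (∫ y, ψ y ∂μ)) := by
  have hmk := hm.markov
  have hμP := hμ.1
  have hequi := fun x {ε : ℝ} (hε : 0 < ε) => hE.exists_abs_avg_sub_le hm hψ x hε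
  obtain ⟨⟨K, hK⟩, C, hC⟩ := hψ
  have hψm := hK.continuous.measurable
  refine tendsto_of_subseq_tendsto fun S hS => ?_
  have hSpos : ∀ᶠ n in atTop, 0 < S n := hS.eventually (eventually_gt_atTop 0)
  have : Nonempty X := ⟨x⟩
  let d := TopologicalSpace.denseSeq X
  -- Compactness of the countable product performs the diagonal extraction over the dense sequence.
  have hcomp : IsCompact (Set.univ.pi fun _ : ℕ => Set.Icc (-C) C) :=
    isCompact_univ_pi fun _ => isCompact_Icc
  have hmem : ∀ᶠ n in atTop, (fun k => avg P ψ (S n) (d k)) ∈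
      Set.univ.pi fun _ : ℕ => Set.Icc (-C) C := by
    filter_upwards [hSpos] with n hn k _ using abs_le.1 (hm.abs_avg_le hC hn (d k))
  obtain ⟨l, -, φ, hφ, hlim⟩ := hcomp.tendsto_subseq' hmem.frequently
  have hT : Tendsto (fun n => S (φ n)) atTop atTop := hS.comp hφ.tendsto_atTop
  have hTpos : ∀ᶠ n in atTop, 0 < S (φ n) := hT.eventually (eventually_gt_atTop 0)
  rw [tendsto_pi_nhds] at hlim
  -- Equicontinuity carries convergence from the dense sequence to every point.
  have hcau : ∀ y, ∃ c, Tendsto (fun n => avg P ψ (S (φ n)) y) atTop (𝓝 c) := by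
    intro y
    refine cauchySeq_tendsto_of_complete (Metric.cauchySeq_iff'.2 fun ε hε => ?_)
    obtain ⟨δ, hδ, h⟩ := hequi y (show 0 < ε / 8 by positivity)
    obtain ⟨k, hk⟩ := (TopologicalSpace.denseRange_denseSeq X).exists_dist_lt y hδ
    have h1 := (hlim k).eventually (Metric.ball_mem_nhds (l k) (show 0 < ε / 8 by positivity))
    obtain ⟨N, hN⟩ := eventually_atTop.1 (h1.and hTpos)
    have hk' : d k ∈ Metric.ball y δ := by rwa [Metric.mem_ball, dist_comm]
    have h2 : ∀ n ≥ N, |avg P ψ (S (φ n)) y - l k| < ε / 2 := by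
      intro n hn
      obtain ⟨h3, h4⟩ := hN n hn
      have h5 := h (d k) hk' _ h4
      have h6 : |avg P ψ (S (φ n)) (d k) - l k| < ε / 8 := h3
      rw [abs_le] at h5
      rw [abs_lt] at *
      constructor <;> linarith
    refine ⟨N, fun n hn => ?_⟩
    have h3 := h2 n hn
    have h4 := h2 N le_rfl
    rw [Real.dist_eq]
    rw [abs_lt] at *
    constructor <;> linarith
  choose f hf using hcau
  have hfC : ∀ y, |f y| ≤ C := fun y => le_of_tendsto (hf y).abs
    (hTpos.mono fun n hn => hm.abs_avg_le hC hn y)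
  have hfc : Continuous f := Metric.continuous_iff'.2 fun y ε hε => by
    obtain ⟨δ, hδ, h⟩ := hequi y (half_pos hε)
    filter_upwards [Metric.ball_mem_nhds y hδ] with w hw
    have h1 : |f y - f w| ≤ ε / 2 := le_of_tendsto ((hf y).sub (hf w)).abs
      (hTpos.mono fun n hn => h w hw _ hn)
    rw [dist_comm, Real.dist_eq]
    linarith
  have hdom : ∀ (ν : Measure X) [IsProbabilityMeasure ν],
      Tendsto (fun n => ∫ y, avg P ψ (S (φ n)) y ∂ν) atTop (𝓝 (∫ y, f y ∂ν)) := by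
    intro ν _
    refine tendsto_integral_filter_of_dominated_convergence (fun _ => C) ?_ ?_
      (integrable_const _) (ae_of_all _ hf)
    · exact hTpos.mono fun n hn => (hm.measurable_avg hψm hn.le).aestronglyMeasurable
    · exact hTpos.mono fun n hn => ae_of_all _ fun y => hm.abs_avg_le hC hn y
  -- The limit is harmonic because the averages are invariant up to an error of order `1 / T`.
  have hinv : ∀ s, 0 ≤ s → ∀ y, act P f s y = f y := by
    intro s hs y
    have h1 : Tendsto (fun n => act P (avg P ψ (S (φ n))) s y) atTop (𝓝 (act P f s y)) :=
      hdom (P s.toNNReal y)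
    have h2 : Tendsto (fun n => act P (avg P ψ (S (φ n))) s y - avg P ψ (S (φ n)) y) atTop
        (𝓝 0) := by
      have h3 := ((tendsto_inv_atTop_zero (𝕜 := ℝ)).comp hT).mul_const (2 * C * s)
      rw [zero_mul] at h3
      refine squeeze_zero_norm' ?_ h3
      filter_upwards [hTpos] with n hn using hm.abs_act_avg_sub_avg_le hψm hC hn hs y
    exact sub_eq_zero.1 (tendsto_nhds_unique (h1.sub (hf y)) h2)
  have h1 : ∫ y, f y ∂μ = ∫ y, ψ y ∂μ := by
    refine tendsto_nhds_unique (hdom μ) (tendsto_const_nhds.congr' ?_)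
    filter_upwards [hTpos] with n hn
    rw [← hm.integral_timeAverage μ hψm hC hn, hμ.integral_timeAverage hm hψm hC hn]
  have h2 : ∫ y, f y ∂μ = f x := by
    rw [integral_congr_ae (ae_of_all _ fun y => hconst f C hfc hfC hinv y x)]
    simp
  refine ⟨φ, ?_⟩
  rw [← h1, h2]
  exact hf x

theorem isLipBounded_of_dist_le {Y : Type*} [MetricSpace Y] {f : Y → ℝ} (h1 : ∃ C, ∀ x y, dist (f x) (f y) ≤ C)
    (h2 : ∃ K, LipschitzWith K f) : IsLipBounded f := by
  refine ⟨h2, ?_⟩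
  obtain ⟨C, hC⟩ := h1
  rcases isEmpty_or_nonempty Y with h | ⟨⟨z⟩⟩
  · exact ⟨0, fun x => h.elim x⟩
  · refine ⟨C + |f z|, fun x => ?_⟩
    have := abs_sub_abs_le_abs_sub (f x) (f z)
    have := hC x z
    rw [Real.dist_eq] at this
    linarith

/-- Bounded Lipschitz functions determine weak convergence, and dominated convergence passes from
point masses to a general initial law. -/
theorem tendsto_timeAverageProb (hm : IsMeasurableSemigroup P) {μ : ProbabilityMeasure X}
    (h : ∀ ψ : X → ℝ, IsLipBounded ψ → ∀ x,
      Tendsto (fun T => avg P ψ T x) atTop (𝓝 (∫ y, ψ y ∂μ)))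
    (ν : ProbabilityMeasure X) : Tendsto (timeAverageProb hm ν) atTop (𝓝 μ) := by
  rw [tendsto_iff_forall_lipschitz_integral_tendsto]
  intro ψ h1 h2
  have hψ := isLipBounded_of_dist_le h1 h2
  have hlim := h ψ hψ
  obtain ⟨⟨K, hK⟩, C, hC⟩ := hψ
  have hψm := hK.continuous.measurable
  have h3 : Tendsto (fun T => ∫ x, avg P ψ T x ∂(ν : Measure X)) atTop
      (𝓝 (∫ _, (∫ y, ψ y ∂(μ : Measure X)) ∂(ν : Measure X))) := by
    refine tendsto_integral_filter_of_dominated_convergence (fun _ => C) ?_ ?_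
      (integrable_const _) (ae_of_all _ hlim)
    · filter_upwards [eventually_gt_atTop 0] with T hT using
        (hm.measurable_avg hψm hT.le).aestronglyMeasurable
    · filter_upwards [eventually_gt_atTop 0] with T hT using
        ae_of_all _ fun y => hm.abs_avg_le hC hT y
  simp only [integral_const, probReal_univ, one_smul] at h3
  refine h3.congr' ?_
  filter_upwards [eventually_gt_atTop 0] with T hT
  rw [coe_timeAverageProb hm ν hT, hm.integral_timeAverage _ hψm hC hT]

/-- The time averages of an invariant measure do not move, so it must equal their limit. -/
theorem eq_of_tendsto_timeAverageProb (hm : IsMeasurableSemigroup P) {μ ν : ProbabilityMeasure X}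
    (h : Tendsto (timeAverageProb hm ν) atTop (𝓝 μ)) (hν : IsInvariantProb P (ν : Measure X)) :
    ν = μ := by
  suffices e : (ν : Measure X) = μ from Subtype.ext e
  refine ext_of_forall_integral_eq_of_IsFiniteMeasure fun ψ => ?_
  rw [tendsto_timeAverageProb_iff hm (eventually_gt_atTop 0)] at h
  refine tendsto_nhds_unique (tendsto_const_nhds.congr' ?_) (h ψ)
  filter_upwards [eventually_gt_atTop 0] with T hT
  exact (hν.integral_timeAverage hm ψ.continuous.measurable ψ.norm_coe_le_norm hT).symm

/-- This supplies the endpoint `T = 0`, needed because tightness is required over all `T > 0`. -/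
theorem tendsto_avg_nhdsGT_zero (hm : IsMeasurableSemigroup P)
    (hCont : IsStochasticallyContinuous P) (ψ : X →ᵇ ℝ) (x : X) :
    Tendsto (fun T => avg P ψ T x) (𝓝[>] 0) (𝓝 (ψ x)) := by
  have hψm := ψ.continuous.measurable
  have hψb : ∀ x, |ψ x| ≤ ‖ψ‖ := ψ.norm_coe_le_norm
  have h1 : Tendsto Real.toNNReal (𝓝[>] 0) (𝓝[>] 0) := by
    refine tendsto_nhdsWithin_iff.2 ⟨?_, ?_⟩
    · have := (continuous_real_toNNReal.tendsto 0).mono_left (nhdsWithin_le_nhds (s := Set.Ioi 0))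
      rwa [Real.toNNReal_zero] at this
    · filter_upwards [self_mem_nhdsWithin] with t ht using Real.toNNReal_pos.2 ht
  have h2 : Tendsto (fun s => act P ψ s x) (𝓝[>] 0) (𝓝 (ψ x)) := (hCont x ψ).comp h1
  rw [Metric.tendsto_nhds]
  intro ε hε
  obtain ⟨δ, hδ, h⟩ := mem_nhdsGT_iff_exists_Ioo_subset.1
    (h2.eventually (Metric.ball_mem_nhds _ (half_pos hε)))
  filter_upwards [Ioo_mem_nhdsGT hδ] with T hT
  rw [Real.dist_eq]
  have e : avg P ψ T x - ψ x = T⁻¹ * ∫ s in (0 : ℝ)..T, (act P ψ s x - ψ x) := by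
    rw [intervalIntegral.integral_sub (hm.intervalIntegrable_act hψm hψb x 0 T)
      intervalIntegrable_const, avg]
    have := hT.1.ne'
    simp [mul_sub, this]
  rw [e, abs_mul, abs_inv, abs_of_pos hT.1, inv_mul_lt_iff₀ hT.1]
  have := intervalIntegral.norm_integral_le_of_norm_le_const (a := 0) (b := T) (C := ε / 2)
    (f := fun s => act P ψ s x - ψ x) fun s hs => by
      rw [Set.uIoc_of_le hT.1.le] at hs
      have h3 : dist (act P ψ s x) (ψ x) < ε / 2 := h ⟨hs.1, hs.2.trans_lt hT.2⟩
      exact h3.le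
  rw [sub_zero, abs_of_pos hT.1] at this
  refine this.trans_lt ?_
  nlinarith [hT.1]

/-- The path `T ↦ Q^T(x, ·)` is weakly continuous and has limits at both `0` and `∞`, so its range
has compact closure; the converse half of Prokhorov's theorem gives tightness. -/
theorem mem_tightPoints [CompleteSpace X] [TopologicalSpace.SeparableSpace X]
    (hm : IsMeasurableSemigroup P) (hCont : IsStochasticallyContinuous P) {x : X}
    {μ : ProbabilityMeasure X}
    (h : Tendsto (timeAverageProb hm ⟨Measure.dirac x, inferInstance⟩) atTop (𝓝 μ)) :
    x ∈ tightPoints P := by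
  have := UniformSpace.secondCountable_of_separable X
  set δx : ProbabilityMeasure X := ⟨Measure.dirac x, inferInstance⟩ with hδx
  set F := timeAverageProb hm δx with hF
  have hint : ∀ (ψ : X →ᵇ ℝ) T, 0 < T → ∫ y, ψ y ∂(timeAverage P T δx) = avg P ψ T x :=
    fun ψ T hT => hm.integral_timeAverageAt x ψ.continuous.measurable ψ.norm_coe_le_norm hT
  have hF0 : Tendsto F (𝓝[>] 0) (𝓝 δx) := by
    refine (tendsto_timeAverageProb_iff hm self_mem_nhdsWithin).2 fun ψ => ?_
    have e : ∫ y, ψ y ∂(δx : Measure X) = ψ x :=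
      integral_dirac' _ _ ψ.continuous.measurable.stronglyMeasurable
    rw [e]
    refine (tendsto_avg_nhdsGT_zero hm hCont ψ x).congr' ?_
    filter_upwards [self_mem_nhdsWithin] with T hT using (hint ψ T hT).symm
  have hFc : ∀ T, 0 < T → ContinuousAt F T := by
    intro T hT
    have e : F T = timeAverageProb hm δx T := rfl
    rw [ContinuousAt, tendsto_timeAverageProb_iff hm (lt_mem_nhds hT)]
    intro ψ
    rw [e, coe_timeAverageProb hm δx hT, hint ψ T hT]
    have hc : ContinuousAt (fun T => avg P ψ T x) T :=
      (continuousAt_inv₀ hT.ne').mul (intervalIntegral.continuous_primitive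
        (fun a b => hm.intervalIntegrable_act ψ.continuous.measurable ψ.norm_coe_le_norm x a b)
        0).continuousAt
    refine hc.tendsto.congr' ?_
    filter_upwards [lt_mem_nhds hT] with T hT using (hint ψ T hT).symm
  have hcompact : ∀ (G : ℝ → ProbabilityMeasure X) ν, Tendsto G (𝓝[>] 0) (𝓝 ν) →
      (∀ T, 0 < T → ContinuousAt G T) → IsCompact (Function.update G 0 ν '' Set.Icc 0 1) := by
    intro G ν h0 hG
    refine isCompact_Icc.image_of_continuousOn (continuousOn_update_iff.2 ⟨fun T hT => ?_, fun _ =>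
      h0.mono_left (nhdsWithin_mono _ fun T hT => ?_)⟩)
    · exact (hG T (lt_of_le_of_ne hT.1.1 (Ne.symm hT.2))).continuousWithinAt
    · exact lt_of_le_of_ne hT.1.1 (Ne.symm hT.2)
  have h1 := hcompact F δx hF0 hFc
  -- Inversion maps the times `T ≥ 1` into `(0, 1]`, with the limit at infinity placed at `0`.
  have h2 := hcompact (fun T => F T⁻¹) μ (h.comp tendsto_inv_nhdsGT_zero) fun T hT =>
    ContinuousAt.comp (f := fun T : ℝ => T⁻¹) (hFc _ (inv_pos.2 hT)) (continuousAt_inv₀ hT.ne')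
  have hcl : IsCompact (closure {ν | ∃ T, 0 < T ∧ ν = F T}) := by
    refine (h1.union h2).closure_of_subset ?_
    rintro _ ⟨T, hT, rfl⟩
    rcases le_total T 1 with h3 | h3
    · exact Or.inl ⟨T, ⟨hT.le, h3⟩, Function.update_of_ne hT.ne' _ _⟩
    · refine Or.inr ⟨T⁻¹, ⟨(inv_pos.2 hT).le, inv_le_one_of_one_le₀ h3⟩, ?_⟩
      rw [Function.update_of_ne (inv_pos.2 hT).ne', inv_inv]
  refine (isTightMeasureSet_of_isCompact_closure hcl).subset ?_
  rintro _ ⟨T, hT, rfl⟩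
  exact ⟨F T, ⟨T, hT, rfl⟩, coe_timeAverageProb hm δx hT⟩

end ConvergenceMetric

/-! ### Second moments of path averages -/

section LargeNumbers

/-- The square of an integral against a diffuse measure is twice the integral over the half plane
`s < t`. -/
theorem sq_integral_eq {m : Measure ℝ} [IsFiniteMeasure m] [NullSingletonClass m] {a : ℝ → ℝ} {C : ℝ}
    (ha : Measurable a) (hC : ∀ s, |a s| ≤ C) :
    (∫ s, a s ∂m) ^ 2 = 2 * ∫ s, ∫ t, (if s < t then a s * a t else 0) ∂m ∂m := by
  have hC0 : 0 ≤ C := (abs_nonneg _).trans (hC 0)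
  have hmul : ∀ s t, |a s * a t| ≤ C * C := fun s t => by
    rw [abs_mul]; exact mul_le_mul (hC s) (hC t) (abs_nonneg _) hC0
  have hm1 : Measurable fun p : ℝ × ℝ => if p.1 < p.2 then a p.1 * a p.2 else 0 :=
    Measurable.ite (measurableSet_lt measurable_fst measurable_snd)
      ((ha.comp measurable_fst).mul (ha.comp measurable_snd)) measurable_const
  have hi1 : Integrable (fun p : ℝ × ℝ => if p.1 < p.2 then a p.1 * a p.2 else 0) (m.prod m) := by
    refine Integrable.of_bound hm1.aestronglyMeasurable (C * C) (ae_of_all _ fun p => ?_)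
    split_ifs
    · exact hmul _ _
    · simp; positivity
  have hi2 := hi1.swap
  have e1 : ∫ s, ∫ t, (if s < t then a s * a t else 0) ∂m ∂m =
      ∫ s, ∫ t, (if t < s then a t * a s else 0) ∂m ∂m := integral_integral_swap hi1
  have e2 : (∫ s, a s ∂m) ^ 2 = ∫ s, ∫ t, a s * a t ∂m ∂m := by
    simp_rw [integral_const_mul, integral_mul_const, sq]
  rw [e2, two_mul]
  nth_rewrite 2 [e1]
  have i1 : Integrable (fun s => ∫ t, (if s < t then a s * a t else 0) ∂m) m :=
    hi1.integral_prod_left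
  have i2 : Integrable (fun s => ∫ t, (if t < s then a t * a s else 0) ∂m) m :=
    hi2.integral_prod_left
  rw [← integral_add i1 i2]
  refine integral_congr_ae (ae_of_all _ fun s => ?_)
  have hb : ∀ q : Prop, ∀ [Decidable q], ∀ t, |if q then a s * a t else 0| ≤ C * C := by
    intro q _ t
    split_ifs
    · exact hmul _ _
    · simp; positivity
  have j1 : Integrable (fun t => if s < t then a s * a t else 0) m :=
    Integrable.of_bound (hm1.comp measurable_prodMk_left).aestronglyMeasurable (C * C)
      (ae_of_all _ fun t => hb _ t)
  have j2 : Integrable (fun t => if t < s then a t * a s else 0) m :=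
    Integrable.of_bound (hm1.comp measurable_prodMk_right).aestronglyMeasurable (C * C)
      (ae_of_all _ fun t => by
        simpa only [Real.norm_eq_abs, mul_comm (a t)] using hb (t < s) t)
  beta_reduce
  rw [← integral_add j1 j2]
  refine integral_congr_ae ?_
  filter_upwards [Measure.ae_ne m s] with t ht
  rcases lt_or_gt_of_ne ht with h | h
  · simp [h, h.not_gt, mul_comm]
  · simp [h, h.not_gt]

variable {X Ω : Type*} [MeasurableSpace X] [MeasurableSpace Ω] {P : ℝ≥0 → Kernel X X}
  {μ : Measure X} {Pr : Measure Ω} {Z : ℝ≥0 → Ω → X}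

namespace IsMarkovProcess

theorem measurable_apply (hZ : IsMarkovProcess P μ Pr Z) (s : ℝ≥0) : Measurable (Z s) :=
  hZ.measurable.comp measurable_prodMk_left

/-- The event `Z s ∈ A` belongs to the past of `s`, so integrating the Markov property over it
yields the mass of each rectangle, and rectangles determine the joint law. -/
theorem map_prodMk (hZ : IsMarkovProcess P μ Pr Z) (hP : IsTransitionSemigroup P) (s t : ℝ≥0) :
    Pr.map (fun ω => (Z s ω, Z (s + t) ω)) = Pr.map (Z s) ⊗ₘ P t := by
  have := hP.markov
  have := hZ.isProbabilityMeasure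
  have hZs := hZ.measurable_apply s
  have hZt := hZ.measurable_apply (s + t)
  have : IsProbabilityMeasure (Pr.map (Z s)) := Measure.isProbabilityMeasure_map hZs.aemeasurable
  have := Measure.isProbabilityMeasure_map (μ := Pr) (hZs.prodMk hZt).aemeasurable
  refine Measure.ext_prod fun {A B} hA hB => ?_
  rw [Measure.map_apply (hZs.prodMk hZt) (hA.prod hB), Measure.compProd_apply_prod hA hB,
    setLIntegral_map hA ((P t).measurable_coe hB) hZs]
  have hBm : MeasurableSet (Z (s + t) ⁻¹' B) := hZt hB
  have hint : Integrable ((Z (s + t) ⁻¹' B).indicator fun _ => (1 : ℝ)) Pr :=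
    (integrable_const (1 : ℝ)).indicator hBm
  have hFle : (⨆ r : Set.Iic s, MeasurableSpace.comap (Z r) inferInstance) ≤
      ‹MeasurableSpace Ω› := iSup_le fun r => (hZ.measurable_apply r).comap_le
  have hAF := le_iSup (fun r : Set.Iic s => MeasurableSpace.comap (Z r) inferInstance)
    ⟨s, Set.mem_Iic.2 le_rfl⟩ _ ⟨A, hA, rfl⟩
  have h1 := setIntegral_condExp hFle hint hAF
  rw [setIntegral_congr_ae (hFle _ hAF) ((hZ.markov s t B hB).mono fun ω h _ => h)] at h1
  have h2 : ∫ ω in Z s ⁻¹' A, (Z (s + t) ⁻¹' B).indicator (fun _ => (1 : ℝ)) ω ∂Pr =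
      Pr.real (Z s ⁻¹' A ∩ Z (s + t) ⁻¹' B) := by
    rw [setIntegral_indicator hBm]
    simp
  have h3 := congrArg ENNReal.ofReal (h1.trans h2)
  rw [ofReal_measureReal, ofReal_integral_eq_lintegral_ofReal ?_
    (ae_of_all _ fun ω => measureReal_nonneg)] at h3
  · have h4 : ∀ ω, ENNReal.ofReal ((P t (Z s ω)).real B) = P t (Z s ω) B := fun ω =>
      ofReal_measureReal
    simp only [h4] at h3
    rw [h3]
    rfl
  · exact Integrable.of_bound (((P t).measurable_coe hB).comp hZs).ennreal_toReal.aestronglyMeasurable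
      1 (ae_of_all _ fun ω => by
        rw [Real.norm_eq_abs, abs_of_nonneg measureReal_nonneg]; exact measureReal_le_one)

theorem map_eq (hZ : IsMarkovProcess P μ Pr Z) (hP : IsTransitionSemigroup P) (t : ℝ≥0) :
    Pr.map (Z t) = P t ∘ₘ μ := by
  have := hP.markov
  have := hZ.isProbabilityMeasure
  have : IsProbabilityMeasure (Pr.map (Z 0)) :=
    Measure.isProbabilityMeasure_map (hZ.measurable_apply 0).aemeasurable
  have h := congrArg Measure.snd (hZ.map_prodMk hP 0 t)
  rwa [Measure.snd_map_prodMk (hZ.measurable_apply 0), Measure.snd_compProd, zero_add,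
    hZ.initial] at h

/-- The two-time correlations of a Markov process. -/
theorem integral_mul (hZ : IsMarkovProcess P μ Pr Z) (hP : IsTransitionSemigroup P) {φ : X → ℝ}
    {C : ℝ} (hφ : Measurable φ) (hC : ∀ x, |φ x| ≤ C) (s t : ℝ≥0) :
    ∫ ω, φ (Z s ω) * φ (Z (s + t) ω) ∂Pr = ∫ ω, φ (Z s ω) * ∫ y, φ y ∂(P t (Z s ω)) ∂Pr := by
  have := hP.markov
  have := hZ.isProbabilityMeasure
  have hZs := hZ.measurable_apply s
  have hZt := hZ.measurable_apply (s + t)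
  have : IsProbabilityMeasure (Pr.map (Z s)) := Measure.isProbabilityMeasure_map hZs.aemeasurable
  have hm : Measurable fun p : X × X => φ p.1 * φ p.2 :=
    (hφ.comp measurable_fst).mul (hφ.comp measurable_snd)
  have h1 := integral_map (μ := Pr) (hZs.prodMk hZt).aemeasurable
    (f := fun p : X × X => φ p.1 * φ p.2) hm.aestronglyMeasurable
  rw [hZ.map_prodMk hP, Measure.integral_compProd
    (Integrable.of_bound hm.aestronglyMeasurable (C * C) (ae_of_all _ fun p => by
      rw [norm_mul]
      exact mul_le_mul (hC _) (hC _) (norm_nonneg _) ((abs_nonneg _).trans (hC p.1))))] at h1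
  rw [← h1]
  simp_rw [integral_const_mul]
  exact integral_map hZs.aemeasurable
    (hφ.stronglyMeasurable.mul hφ.stronglyMeasurable.integral_kernel).aestronglyMeasurable

theorem integral_comp (hZ : IsMarkovProcess P μ Pr Z) (hm : IsMeasurableSemigroup P)
    [IsProbabilityMeasure μ] {φ : X → ℝ} {C : ℝ} (hφ : Measurable φ) (hC : ∀ x, |φ x| ≤ C)
    (s : ℝ) : ∫ ω, φ (Z s.toNNReal ω) ∂Pr = ∫ x, act P φ s x ∂μ := by
  rw [← hm.integral_comp_eq μ hφ hC s, ← hZ.map_eq hm.toIsTransitionSemigroup,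
    integral_map (hZ.measurable_apply _).aemeasurable hφ.aestronglyMeasurable]

/-- The second moment of the time average of `φ` along a Markov process is controlled by a bound
`g` on the time averages of `φ` over long intervals. -/
theorem integral_sq_le (hZ : IsMarkovProcess P μ Pr Z) (hm : IsMeasurableSemigroup P)
    [IsProbabilityMeasure μ] {φ : X → ℝ} {C : ℝ} (hφ : Measurable φ) (hC : ∀ x, |φ x| ≤ C)
    {g : X → ℝ} (hg : Measurable g) (hg0 : ∀ x, 0 ≤ g x) (hgC : ∀ x, |g x| ≤ C) {R : ℝ}
    (hR : 0 < R) (hgR : ∀ u, R ≤ u → ∀ x, |avg P φ u x| ≤ g x) {T : ℝ} (hT : 0 < T) :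
    ∫ ω, (T⁻¹ * ∫ t in (0 : ℝ)..T, φ (Z t.toNNReal ω)) ^ 2 ∂Pr ≤
      T⁻¹ * (2 * C ^ 2 * R) + 2 * C * ∫ x, g x ∂(timeAverage P T μ) := by
  have := hZ.isProbabilityMeasure
  have hP := hm.toIsTransitionSemigroup
  obtain ⟨x₀⟩ : Nonempty X := nonempty_of_isProbabilityMeasure μ
  have hC0 : 0 ≤ C := (abs_nonneg _).trans (hC x₀)
  let m : Measure ℝ := volume.restrict (Set.Ioc 0 T)
  let A : Ω → ℝ → ℝ := fun ω s => φ (Z s.toNNReal ω)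
  have hA : Measurable fun p : Ω × ℝ => A p.1 p.2 :=
    hφ.comp (hZ.measurable.comp
      ((measurable_real_toNNReal.comp measurable_snd).prodMk measurable_fst))
  have hAC : ∀ ω s, |A ω s| ≤ C := fun ω s => hC _
  let k : Ω → ℝ → ℝ → ℝ := fun ω s t => if s < t then A ω s * A ω t else 0
  have hk : Measurable fun p : (Ω × ℝ) × ℝ => k p.1.1 p.1.2 p.2 :=
    Measurable.ite (measurableSet_lt (by fun_prop) (by fun_prop))
      ((hA.comp measurable_fst).mul (hA.comp (by fun_prop :
        Measurable fun p : (Ω × ℝ) × ℝ => (p.1.1, p.2)))) measurable_const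
  have hkC : ∀ ω s t, |k ω s t| ≤ C * C := fun ω s t => by
    simp only [k]
    split_ifs
    · rw [abs_mul]; exact mul_le_mul (hC _) (hC _) (abs_nonneg _) hC0
    · simp; positivity
  have e1 : ∀ ω, (∫ s in (0 : ℝ)..T, φ (Z s.toNNReal ω)) ^ 2 = 2 * ∫ s, ∫ t, k ω s t ∂m ∂m :=
    fun ω => by
      rw [intervalIntegral.integral_of_le hT.le]
      exact sq_integral_eq (hA.comp measurable_prodMk_left) (hAC ω)
  have e2 : ∫ ω, ∫ s, ∫ t, k ω s t ∂m ∂m ∂Pr = ∫ s, ∫ ω, ∫ t, k ω s t ∂m ∂Pr ∂m := by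
    refine integral_integral_swap ?_
    refine Integrable.of_bound (hk.stronglyMeasurable.integral_prod_right').aestronglyMeasurable
      (C * C * m.real Set.univ) (ae_of_all _ fun p => ?_)
    exact norm_integral_le_of_norm_le_const (ae_of_all _ fun t => hkC p.1 p.2 t)
  have hcor : ∀ s, 0 ≤ s → ∀ t, ∫ ω, k ω s t ∂Pr =
      ∫ ω, (if s < t then φ (Z s.toNNReal ω) * act P φ (t - s) (Z s.toNNReal ω) else 0) ∂Pr := by
    intro s hs t
    by_cases hst : s < t
    · simp only [k, hst, if_true, A]
      have h := hZ.integral_mul hP hφ hC s.toNNReal (t - s).toNNReal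
      rw [← Real.toNNReal_add hs (sub_nonneg.2 hst.le), add_sub_cancel] at h
      exact h
    · simp [k, hst]
  -- Conditioning at the earlier time `s` replaces the future of the path by the semigroup, leaving
  -- the integral of `P_r φ` over the remaining time `T - s`.
  have hinner : ∀ s, 0 ≤ s → s ≤ T → ∫ ω, ∫ t, k ω s t ∂m ∂Pr =
      ∫ ω, φ (Z s.toNNReal ω) * (∫ r in (0 : ℝ)..(T - s), act P φ r (Z s.toNNReal ω)) ∂Pr := by
    intro s hs hsT
    have hZs := hZ.measurable_apply s.toNNReal
    rw [integral_integral_swap]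
    · simp_rw [hcor s hs]
      rw [integral_integral_swap]
      · refine integral_congr_ae (ae_of_all _ fun ω => ?_)
        have h1 : ∀ t, (if s < t then φ (Z s.toNNReal ω) * act P φ (t - s) (Z s.toNNReal ω) else 0)
            = (Set.Ioi s).indicator
              (fun t => φ (Z s.toNNReal ω) * act P φ (t - s) (Z s.toNNReal ω)) t := fun t => by
          simp [Set.indicator_apply]
        simp only [h1]
        have h2 : Set.Ioc 0 T ∩ Set.Ioi s = Set.Ioc s T := by
          ext t
          simp only [Set.mem_inter_iff, Set.mem_Ioc, Set.mem_Ioi]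
          constructor
          · rintro ⟨⟨_, h⟩, h'⟩; exact ⟨h', h⟩
          · rintro ⟨h, h'⟩; exact ⟨⟨hs.trans_lt h, h'⟩, h⟩
        rw [setIntegral_indicator measurableSet_Ioi, h2, integral_const_mul,
          ← intervalIntegral.integral_of_le hsT,
          intervalIntegral.integral_comp_sub_right (fun r => act P φ r (Z s.toNNReal ω)), sub_self]
      · refine Integrable.of_bound (Measurable.aestronglyMeasurable ?_) (C * C)
          (ae_of_all _ fun p => ?_)
        · refine Measurable.ite (measurableSet_lt measurable_const measurable_fst) ?_
            measurable_const
          exact ((hφ.comp hZs).comp measurable_snd).mul ((hm.measurable_act hφ).comp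
            ((measurable_fst.sub_const s).prodMk (hZs.comp measurable_snd)))
        · simp only [Function.uncurry]
          split_ifs
          · rw [norm_mul]
            exact mul_le_mul (hC _) (hm.abs_act_le hC _ _) (norm_nonneg _) hC0
          · simp; positivity
    · exact Integrable.of_bound (hk.comp (by fun_prop :
        Measurable fun p : Ω × ℝ => ((p.1, s), p.2))).aestronglyMeasurable (C * C)
        (ae_of_all _ fun p => hkC p.1 s p.2)
  -- Windows shorter than `R` are bounded trivially by `R * C`; on longer ones `g` controls the
  -- average and the length is at most `T`.
  have hbd : ∀ u, 0 ≤ u → u ≤ T → ∀ x, |∫ r in (0 : ℝ)..u, act P φ r x| ≤ R * C + T * g x := by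
    intro u hu huT x
    rcases lt_or_ge u R with h | h
    · have h1 := abs_intervalIntegral_le (a := 0) (b := u)
        (fun s => hm.abs_act_le hC s x) hu
      have h2 : 0 ≤ T * g x := mul_nonneg hT.le (hg0 x)
      nlinarith
    · have hu0 : 0 < u := hR.trans_le h
      have h1 := hgR u h x
      rw [avg, abs_mul, abs_inv, abs_of_pos hu0, inv_mul_le_iff₀ hu0] at h1
      have h2 : u * g x ≤ T * g x := mul_le_mul_of_nonneg_right huT (hg0 x)
      have h3 : 0 ≤ R * C := by positivity
      linarith
  have hgi : Integrable (fun s => ∫ x, act P g s x ∂μ) m :=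
    Integrable.of_bound ((hm.measurable_act hg).stronglyMeasurable.integral_prod_right'
      (ν := μ)).aestronglyMeasurable C
      (ae_of_all _ fun s => abs_integral_le_of_bound fun x => hm.abs_act_le hgC s x)
  have hgi' : Integrable (fun s => R * C + T * ∫ x, act P g s x ∂μ) m :=
    (integrable_const _).add (hgi.const_mul T)
  have hmain : |∫ s, ∫ ω, ∫ t, k ω s t ∂m ∂Pr ∂m| ≤
      ∫ s, C * (R * C + T * ∫ x, act P g s x ∂μ) ∂m := by
    rw [← Real.norm_eq_abs]
    refine norm_integral_le_of_norm_le (hgi'.const_mul C) ?_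
    filter_upwards [ae_restrict_mem measurableSet_Ioc] with s hs
    rw [hinner s hs.1.le hs.2, ← hZ.integral_comp hm hg hgC s]
    have hgZ : Integrable (fun ω => g (Z s.toNNReal ω)) Pr :=
      Integrable.of_bound (hg.comp (hZ.measurable_apply _)).aestronglyMeasurable C
        (ae_of_all _ fun ω => hgC _)
    have hgZ' : Integrable (fun ω => R * C + T * g (Z s.toNNReal ω)) Pr :=
      (integrable_const _).add (hgZ.const_mul T)
    have h1 : C * (R * C + T * ∫ ω, g (Z s.toNNReal ω) ∂Pr) =
        ∫ ω, C * (R * C + T * g (Z s.toNNReal ω)) ∂Pr := by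
      rw [integral_const_mul, integral_add (integrable_const _) (hgZ.const_mul T),
        integral_const_mul T]
      simp
    rw [h1]
    refine norm_integral_le_of_norm_le (hgZ'.const_mul C) (ae_of_all _ fun ω => ?_)
    rw [norm_mul]
    exact mul_le_mul (hC _) (hbd _ (sub_nonneg.2 hs.2) (by linarith [hs.1]) _) (norm_nonneg _) hC0
  have hval : ∫ s, C * (R * C + T * ∫ x, act P g s x ∂μ) ∂m =
      C * (R * C * T + T * (T * ∫ x, g x ∂(timeAverage P T μ))) := by
    rw [integral_const_mul, integral_add (integrable_const _) (hgi.const_mul T),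
      integral_const_mul T, hm.integral_timeAverage' μ hg hgC hT,
      intervalIntegral.integral_of_le hT.le, mul_inv_cancel_left₀ hT.ne']
    simp [m, hT.le, mul_comm]
  rw [hval] at hmain
  have e3 : ∀ ω, (T⁻¹ * ∫ s in (0 : ℝ)..T, φ (Z s.toNNReal ω)) ^ 2 =
      T⁻¹ ^ 2 * (2 * ∫ s, ∫ t, k ω s t ∂m ∂m) := fun ω => by rw [mul_pow, e1]
  rw [integral_congr_ae (ae_of_all _ e3), integral_const_mul, integral_const_mul, e2]
  have h1 := (le_abs_self _).trans hmain
  calc T⁻¹ ^ 2 * (2 * ∫ s, ∫ ω, ∫ t, k ω s t ∂m ∂Pr ∂m)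
      ≤ T⁻¹ ^ 2 * (2 * (C * (R * C * T + T * (T * ∫ x, g x ∂(timeAverage P T μ))))) := by gcongr
    _ = _ := by field_simp

end IsMarkovProcess

end LargeNumbers

/-! ### The weak law of large numbers -/

section LargeNumbersLimit

variable {X Ω : Type*} [MetricSpace X] [MeasurableSpace X] [BorelSpace X] [MeasurableSpace Ω]
  {P : ℝ≥0 → Kernel X X}

/-- If the time averages of a bounded Lipschitz function vanish pointwise in the limit, their suprema
over long intervals form bounded continuous functions that tend to zero. -/
theorem EProperty.exists_bound (hE : EProperty P) (hm : IsMeasurableSemigroup P) {φ : X → ℝ} {C : ℝ}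
    (hφ : IsLipBounded φ) (hC : ∀ x, |φ x| ≤ C)
    (hlim : ∀ x, Tendsto (fun T => avg P φ T x) atTop (𝓝 0)) :
    ∃ g : ℕ → X → ℝ, (∀ n, Continuous (g n)) ∧ (∀ n x, 0 ≤ g n x) ∧ (∀ n x, |g n x| ≤ C) ∧
      (∀ (n : ℕ) u, (n : ℝ) + 1 ≤ u → ∀ x, |avg P φ u x| ≤ g n x) ∧
      ∀ x, Tendsto (fun n => g n x) atTop (𝓝 0) := by
  let g : ℕ → X → ℝ := fun n x => ⨆ u : Set.Ici ((n : ℝ) + 1), |avg P φ u x|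
  have hpos : ∀ (n : ℕ) (u : Set.Ici ((n : ℝ) + 1)), 0 < (u : ℝ) := fun n u =>
    lt_of_lt_of_le (by positivity) u.2
  have hb : ∀ (n : ℕ) x, BddAbove (Set.range fun u : Set.Ici ((n : ℝ) + 1) => |avg P φ u x|) :=
    fun n x => ⟨C, by rintro _ ⟨u, rfl⟩; exact hm.abs_avg_le hC (hpos n u) x⟩
  have hle : ∀ (n : ℕ) (u : Set.Ici ((n : ℝ) + 1)) x, |avg P φ u x| ≤ g n x := fun n u x =>
    le_ciSup (hb n x) u
  have hne : ∀ n : ℕ, Nonempty (Set.Ici ((n : ℝ) + 1)) := fun n => ⟨⟨_, Set.mem_Ici.2 le_rfl⟩⟩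
  have h0 : ∀ n x, 0 ≤ g n x := fun n x => (abs_nonneg _).trans (hle n ⟨_, Set.mem_Ici.2 le_rfl⟩ x)
  refine ⟨g, fun n => ?_, h0, fun n x => ?_, fun n u hu x => hle n ⟨u, hu⟩ x, fun x => ?_⟩
  · refine Metric.continuous_iff'.2 fun x ε hε => ?_
    obtain ⟨δ, hδ, h⟩ := hE.exists_abs_avg_sub_le hm hφ x (half_pos hε)
    filter_upwards [Metric.ball_mem_nhds x hδ] with y hy
    have h1 : g n y ≤ g n x + ε / 2 := ciSup_le fun u => by
      have h3 := h y hy u (hpos n u)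
      have h4 := hle n u x
      rw [abs_le] at *
      constructor <;> linarith
    have h2 : g n x ≤ g n y + ε / 2 := ciSup_le fun u => by
      have h3 := h y hy u (hpos n u)
      have h4 := hle n u y
      rw [abs_le] at *
      constructor <;> linarith
    rw [Real.dist_eq, abs_lt]
    constructor <;> linarith
  · rw [abs_of_nonneg (h0 n x)]
    exact ciSup_le fun u => hm.abs_avg_le hC (hpos n u) x
  · rw [Metric.tendsto_atTop]
    intro ε hε
    obtain ⟨S, hS⟩ := eventually_atTop.1
      ((hlim x).eventually (Metric.ball_mem_nhds 0 (half_pos hε)))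
    obtain ⟨N, hN⟩ := exists_nat_ge S
    refine ⟨N, fun n hn => ?_⟩
    have h1 : g n x ≤ ε / 2 := ciSup_le fun u => by
      have h2 : (N : ℝ) ≤ n := by exact_mod_cast hn
      have h3 : (n : ℝ) + 1 ≤ u := u.2
      have h4 := hS u (by linarith)
      rw [dist_zero_right] at h4
      exact h4.le
    rw [Real.dist_eq, sub_zero, abs_of_nonneg (h0 n x)]
    linarith

/-- The weak law of large numbers for Markov processes with the e-property. -/
theorem IsMarkovProcess.tendstoInMeasure (hE : EProperty P) (hm : IsMeasurableSemigroup P)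
    {μ' : ProbabilityMeasure X}
    (hlim : ∀ ψ : X → ℝ, IsLipBounded ψ → ∀ x,
      Tendsto (fun T => avg P ψ T x) atTop (𝓝 (∫ y, ψ y ∂μ')))
    {ψ : X → ℝ} (hψ : IsLipBounded ψ) {μ : Measure X} [IsProbabilityMeasure μ] {Pr : Measure Ω}
    {Z : ℝ≥0 → Ω → X} (hZ : IsMarkovProcess P μ Pr Z) :
    TendstoInMeasure Pr (fun (T : ℝ) (ω : Ω) => T⁻¹ * ∫ t in (0 : ℝ)..T, ψ (Z t.toNNReal ω))
      atTop (fun _ => ∫ x, ψ x ∂μ') := by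
  have := hZ.isProbabilityMeasure
  have hmk := hm.markov
  obtain ⟨⟨K, hK⟩, C₀, hC₀⟩ := hψ
  set c := ∫ x, ψ x ∂(μ' : Measure X) with hc
  set φ : X → ℝ := fun x => ψ x - c with hφ
  set C := C₀ + |c|
  have hφL : IsLipBounded φ := ⟨⟨K, LipschitzWith.of_dist_le_mul fun x y => by
    simpa [hφ] using hK.dist_le_mul x y⟩, C, fun x => (abs_sub _ _).trans (by
      have := hC₀ x
      simp only [C]
      linarith)⟩
  have hφC : ∀ x, |φ x| ≤ C := fun x => (abs_sub _ _).trans (by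
      have := hC₀ x
      simp only [C]
      linarith)
  have hψm := hK.continuous.measurable
  have hφm : Measurable φ := hψm.sub_const c
  have hφ0 : ∫ x, φ x ∂(μ' : Measure X) = 0 := by
    rw [integral_sub (integrable_of_bound hψm hC₀) (integrable_const _)]
    simp [hc]
  obtain ⟨g, hgc, hg0, hgC, hgR, hg⟩ := hE.exists_bound hm hφL hφC fun x => by
    have := hlim φ hφL x
    rwa [hφ0] at this
  let V : ℝ → ℝ := fun T => ∫ ω, (T⁻¹ * ∫ t in (0 : ℝ)..T, φ (Z t.toNNReal ω)) ^ 2 ∂Pr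
  obtain ⟨x₀⟩ : Nonempty X := nonempty_of_isProbabilityMeasure μ
  have hC0 : 0 ≤ C := (abs_nonneg _).trans (hφC x₀)
  have hV : Tendsto V atTop (𝓝 0) := by
    refine Metric.tendsto_nhds.2 fun ε hε => ?_
    have h1 : Tendsto (fun n => 2 * C * ∫ x, g n x ∂(μ' : Measure X)) atTop (𝓝 0) := by
      have := tendsto_integral_of_dominated_convergence (μ := (μ' : Measure X)) (fun _ => C)
        (fun n => (hgc n).measurable.aestronglyMeasurable) (integrable_const _)
        (fun n => ae_of_all _ (hgC n)) (ae_of_all _ hg)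
      simpa using this.const_mul (2 * C)
    -- The order of limits matters: `n` is fixed first, making the integral of `g n` small, and then
    -- `T` tends to infinity, using weak convergence on the bounded continuous `g n`.
    obtain ⟨n, hn⟩ := (h1.eventually (gt_mem_nhds hε)).exists
    let G : X →ᵇ ℝ := BoundedContinuousFunction.ofNormedAddCommGroup (g n) (hgc n) C (hgC n)
    have h2 : Tendsto (fun T : ℝ => ∫ x, G x ∂(timeAverage P T μ)) atTop
        (𝓝 (∫ x, G x ∂(μ' : Measure X))) :=
      (tendsto_timeAverageProb_iff (μ := ⟨μ, inferInstance⟩) hm (eventually_gt_atTop 0)).1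
        (tendsto_timeAverageProb hm hlim _) G
    have h3 := ((tendsto_inv_atTop_zero (𝕜 := ℝ)).mul_const (2 * C ^ 2 * ((n : ℝ) + 1))).add
      (h2.const_mul (2 * C))
    rw [zero_mul, zero_add] at h3
    filter_upwards [h3.eventually (gt_mem_nhds hn), eventually_gt_atTop 0] with T hT hT0
    have h4 := hZ.integral_sq_le hm hφm hφC (hgc n).measurable (hg0 n) (hgC n)
      (R := (n : ℝ) + 1) (by positivity) (hgR n) hT0
    have h5 : 0 ≤ V T := integral_nonneg fun ω => sq_nonneg _
    rw [Real.dist_eq, sub_zero, abs_of_nonneg h5]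
    exact h4.trans_lt hT
  have hA : ∀ {f : X → ℝ}, Measurable f →
      Measurable fun p : Ω × ℝ => f (Z p.2.toNNReal p.1) := fun hf =>
    hf.comp (hZ.measurable.comp
      ((measurable_real_toNNReal.comp measurable_snd).prodMk measurable_fst))
  rw [tendstoInMeasure_iff_measureReal_dist]
  intro ε hε
  have hV' := hV.const_mul (ε ^ 2)⁻¹
  rw [mul_zero] at hV'
  refine squeeze_zero' (Eventually.of_forall fun T => measureReal_nonneg) ?_ hV'
  filter_upwards [eventually_gt_atTop 0] with T hT
  have e : ∀ ω, T⁻¹ * (∫ t in (0 : ℝ)..T, ψ (Z t.toNNReal ω)) - c =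
      T⁻¹ * ∫ t in (0 : ℝ)..T, φ (Z t.toNNReal ω) := by
    intro ω
    have hi : IntervalIntegrable (fun t : ℝ => ψ (Z t.toNNReal ω)) volume 0 T := by
      rw [intervalIntegrable_iff]
      exact Measure.integrableOn_of_bounded (M := C₀) (by simp)
        ((hA hψm).comp measurable_prodMk_left).aestronglyMeasurable
        (ae_of_all _ fun t => hC₀ _)
    rw [hφ, intervalIntegral.integral_sub hi intervalIntegrable_const]
    simp [mul_sub, hT.ne']
  have hmeas : Measurable fun ω => T⁻¹ * ∫ t in (0 : ℝ)..T, φ (Z t.toNNReal ω) := by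
    simp_rw [intervalIntegral.integral_of_le hT.le]
    exact ((hA hφm).stronglyMeasurable.integral_prod_right'
      (ν := volume.restrict (Set.Ioc 0 T))).measurable.const_mul _
  have hbd : ∀ ω, |T⁻¹ * ∫ t in (0 : ℝ)..T, φ (Z t.toNNReal ω)| ≤ C := fun ω => by
    rw [abs_mul, abs_inv, abs_of_pos hT, inv_mul_le_iff₀ hT]
    have := abs_intervalIntegral_le (a := 0) (b := T)
      (f := fun t => φ (Z t.toNNReal ω)) (fun t => hφC _) hT.le
    linarith
  have hint : Integrable (fun ω => (T⁻¹ * ∫ t in (0 : ℝ)..T, φ (Z t.toNNReal ω)) ^ 2) Pr :=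
    integrable_of_bound (C := C ^ 2) (hmeas.pow_const 2) fun ω => by
      rw [abs_pow]
      have := hbd ω
      gcongr
  -- Chebyshev's inequality, in the form of Markov's inequality for the square.
  have h1 := mul_meas_ge_le_integral_of_nonneg (ae_of_all _ fun ω => sq_nonneg _) hint (ε ^ 2)
  rw [le_inv_mul_iff₀ (by positivity)]
  refine le_trans ?_ h1
  refine mul_le_mul_of_nonneg_left (measureReal_mono fun ω h => ?_) (sq_nonneg ε)
  rw [Set.mem_ofPred_eq] at h ⊢
  rw [Real.dist_eq, e ω] at h
  rw [← sq_abs (T⁻¹ * _)]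
  gcongr

end LargeNumbersLimit

end MarkovErgodic

/-! ### The main theorem -/

open MarkovErgodic in
theorem theorem2 {X : Type*} [MetricSpace X] [CompleteSpace X]
    [TopologicalSpace.SeparableSpace X] [MeasurableSpace X] [BorelSpace X]
    (P : ℝ≥0 → Kernel X X)
    (hP : MarkovErgodic.IsTransitionSemigroup P)
    (hFeller : MarkovErgodic.IsFeller P)
    (hCont : MarkovErgodic.IsStochasticallyContinuous P)
    (hE : MarkovErgodic.EProperty P)
    (hLower : ∃ z : X, ∀ δ : ℝ, 0 < δ → ∀ x : X,
      0 < liminf (fun T : ℝ => MarkovErgodic.timeAverageAt P T x (Metric.ball z δ)) atTop)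
    (hUnif : ∃ z : X, ∀ A : Set X, Bornology.IsBounded A → ∀ δ : ℝ, 0 < δ →
      0 < ⨅ x ∈ A,
        liminf (fun T : ℝ => MarkovErgodic.timeAverageAt P T x (Metric.ball z δ)) atTop)
    (hConc : ∀ ε : ℝ, 0 < ε → ∀ x : X, ∃ D : Set X, Bornology.IsBounded D ∧ MeasurableSet D ∧
      ENNReal.ofReal (1 - ε) <
        liminf (fun T : ℝ => MarkovErgodic.timeAverageAt P T x D) atTop) :
    MarkovErgodic.tightPoints P = Set.univ ∧
    MarkovErgodic.IsWeakStarMeanErgodic P ∧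
    ∃ μ' : Measure X,
      MarkovErgodic.IsInvariantProb P μ' ∧
      (∀ ν : Measure X, MarkovErgodic.IsInvariantProb P ν → ν = μ') ∧
      MarkovErgodic.IsWeakStarMeanErgodicTo P μ' ∧
      ∀ ψ : X → ℝ, MarkovErgodic.IsLipBounded ψ →
        ∀ μ : Measure X, IsProbabilityMeasure μ →
          ∀ {Ω : Type*} [MeasurableSpace Ω] (Pr : Measure Ω) (Z : ℝ≥0 → Ω → X),
            MarkovErgodic.IsMarkovProcess P μ Pr Z →
            TendstoInMeasure Pr
              (fun (T : ℝ) (ω : Ω) => T⁻¹ * ∫ t in (0 : ℝ)..T, ψ (Z t.toNNReal ω))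
              atTop (fun _ => ∫ x, ψ x ∂μ') := by
  have hm := isMeasurableSemigroup hP hFeller hCont
  obtain ⟨z, hz⟩ := hUnif
  -- The uniform lower bound on the bounded set `{z}` is the lower bound at `z` itself.
  have htight : z ∈ tightPoints P := isTightMeasureSet_timeAverageAt hm hE fun δ hδ => by
    simpa using hz {z} Bornology.isBounded_singleton δ hδ
  obtain ⟨μ', hμ'⟩ := exists_isInvariantProb hm hFeller htight
  have hlim : ∀ ψ : X → ℝ, IsLipBounded ψ → ∀ x,
      Tendsto (fun T => avg P ψ T x) atTop (𝓝 (∫ y, ψ y ∂μ')) := fun ψ hψ x =>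
    tendsto_avg hm hE (fun f C hf hC hinv x y =>
      (hm.eq_of_invariant hz hConc hf hC hinv x).trans
        (hm.eq_of_invariant hz hConc hf hC hinv y).symm) hμ' hψ x
  let μ₁ : ProbabilityMeasure X := ⟨μ', hμ'.1⟩
  have hconv : ∀ ν : ProbabilityMeasure X, Tendsto (timeAverageProb hm ν) atTop (𝓝 μ₁) :=
    tendsto_timeAverageProb hm hlim
  have hergodic : IsWeakStarMeanErgodicTo P μ' := ⟨hμ'.1, fun ν hν ψ =>
    (tendsto_timeAverageProb_iff (μ := ⟨ν, hν⟩) hm (eventually_gt_atTop 0)).1 (hconv _) ψ⟩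
  refine ⟨Set.eq_univ_of_forall fun x => mem_tightPoints hm hCont (hconv _), ⟨μ', hergodic⟩,
    μ', hμ', fun ν hν => ?_, hergodic, fun ψ hψ μ hμ Ω _ Pr Z hZ =>
      hZ.tendstoInMeasure (μ' := μ₁) hE hm hlim hψ⟩
  exact congrArg Subtype.val
    (eq_of_tendsto_timeAverageProb (ν := ⟨ν, hν.1⟩) hm (hconv ⟨ν, hν.1⟩) hν)
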